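/- Let $\mathcal H$ be a real separable Hilbert space and let $q\in(-1,1)$, with the convention $0^0:=1$. For $n\ge 1$ let $P_q^{(n)}$ be the bounded, strictly positive operator on $\mathcal H^{\otimes n}$ with $P_q^{(n)}f_1\otimes\dots\otimes f_n=\sum_{\pi\in S_n}q^{\operatorname{inv}(\pi)}f_{\pi(1)}\otimes\dots\otimes f_{\pi(n)}$, where $\operatorname{inv}(\pi)$ is the number of inversions of $\pi$. Let $\mathcal F_q(\mathcal H)=\bigoplus_{n\ge0}\mathcal F_q^{(n)}(\mathcal H)$, where $\mathcal F^{(0)}_q(\mathcal H)=\mathbb R$ and, for $n\ge1$, $\mathcal F^{(n)}_q(\mathcal H)$ is $\mathcal H^{\otimes n}$ with the scalar product $(f,g)\mapsto(P_q^{(n)}f,g)_{\mathcal H^{\otimes n}}$. Let $\Omega=(1,0,0,\dots)$. For $\varphi\in\mathcal H$ let $a^+(\varphi),a^-(\varphi)$ be the bounded operators on $\mathcal F_q(\mathcal H)$ with $a^+(\varphi)f=\varphi\otimes f$, $a^-(\varphi)\Omega=0$ and $$a^-(\varphi)f_1\otimes\dots\otimes f_n=\sum_{i=1}^n q^{i-1}(\varphi,f_i)_{\mathcal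 H}\,f_1\otimes\dots\otimes\check f_i\otimes\dots\otimes f_n ,$$ where $\check f_i$ denotes the absence of $f_i$, and put $\langle\omega,\varphi\rangle:=a^+(\varphi)+a^-(\varphi)$. Write $\mathcal H^{\otimes_{\mathbf a}n}$ for the algebraic tensor power ($\mathcal H^{\otimes_{\mathbf a}0}=\mathbb R$). For $f\in\mathcal H^{\otimes_{\mathbf a}n}$ let $\langle\omega^{\otimes n},f\rangle$ be defined by linearity from $\langle\omega^{\otimes n},f_1\otimes\dots\otimes f_n\rangle:=\langle\omega,f_1\rangle\cdots\langle\omega,f_n\rangle$ (and $\langle\omega^{\otimes0},c\rangle:=c\,1$). Let $\mathcal P$ be the real unital algebra generated by the operators $\langle\omega,\varphi\rangle$, $\varphi\in\mathcal H$, that is, the set of all $P=\sum_{i=0}^n\langle\omega^{\otimes i},f^{(i)}\rangle$ with $f^{(i)}\in\mathcal H^{\otimes_{\mathbf a}i}$, and let $\mathcal P_k$ be the set of those $P$ that can be so written with $n\le k$. Let $\mu(P):=(P\Omega,\Omega)_{\mathcal F_q(\mathcal H)}$ for $P\in\mathcal P$, and let $L^2(\mu)$ be the completion of $\mathcal P$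 for the form $(P_1,P_2)_{L^2(\mu)}:=\mu(P_2^*P_1)=(P_1\Omega,P_2\Omega)_{\mathcal F_q(\mathcal H)}$. The canonical map $\mathcal P\to L^2(\mu)$ is injective, so that $\mathcal P$ is regarded as a subset of $L^2(\mu)$, and $P\mapsto P\Omega$ extends by continuity to a unitary operator $I:L^2(\mu)\to\mathcal F_q(\mathcal H)$. Let $\mathcal{MP}_k$ be the closure of $\mathcal P_k$ in $L^2(\mu)$, let $\mathcal{OP}_k:=\mathcal{MP}_k\ominus\mathcal{MP}_{k-1}$ ($\mathcal{OP}_0:=\mathcal{MP}_0$), and for $f\in\mathcal H^{\otimes_{\mathbf a}n}$ let $\langle{:}\omega^{\otimes n}{:},f\rangle$ be the orthogonal projection of $\langle\omega^{\otimes n},f\rangle$ onto $\mathcal{OP}_n$. Let $\mathcal W$ be the linear span of the operators $a^+(f_1)\cdots a^+(f_n)a^-(g_1)\cdots a^-(g_m)$ with $n,m\ge0$ and $f_i,g_j\in\mathcal H$ (the identity for $n=m=0$), with the Wick product, i.e. the well-defined bilinear operation $\diamond$ on $\mathcal W$ with $$\begin{aligned}&\big(a^+(f_1)\cdots a^+(f_n)a^-(g_1)\cdots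 a^-(g_m)\big)\diamond\big(a^+(\varphi_1)\cdots a^+(\varphi_k)a^-(\psi_1)\cdots a^-(\psi_l)\big)\\&\quad=q^{km}\,a^+(f_1)\cdots a^+(f_n)a^+(\varphi_1)\cdots a^+(\varphi_k)\,a^-(g_1)\cdots a^-(g_m)a^-(\psi_1)\cdots a^-(\psi_l).\end{aligned}$$ Finally, let $\mathcal G^{\mathbf a}_{\mathrm{fin}}(\mathcal H)\subset\mathcal F_q(\mathcal H)$ be the algebra, under addition and the tensor multiplication $\otimes$, of all finite vectors $(f^{(0)},\dots,f^{(n)},0,0,\dots)$ with $f^{(i)}\in\mathcal H^{\otimes_{\mathbf a}i}$. **Corollary.** We have $\mathcal P\subset\mathcal W$, and $P_1\diamond P_2\in\mathcal P$ for all $P_1,P_2\in\mathcal P$. Thus $\mathcal P$ is an associative algebra for the addition and the Wick multiplication $\diamond$, with neutral element $1$. Furthermore, $I\mathcal P=\mathcal G^{\mathbf a}_{\mathrm{fin}}(\mathcal H)$, and $$I(P_1\diamond P_2)=IP_1\otimes IP_2\qquad\text{for all }P_1,P_2\in\mathcal P.$$ In particular, for all $n,m\ge0$, $f\in\mathcal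 H^{\otimes_{\mathbf a}n}$ and $g\in\mathcal H^{\otimes_{\mathbf a}m}$, the elements $\langle{:}\omega^{\otimes n}{:},f\rangle$ and $\langle{:}\omega^{\otimes m}{:},g\rangle$ of $L^2(\mu)$ belong to $\mathcal P$, and $$\langle{:}\omega^{\otimes n}{:},f\rangle\diamond\langle{:}\omega^{\otimes m}{:},g\rangle=\langle{:}\omega^{\otimes(n+m)}{:},f\otimes g\rangle .$$ -/

import Mathlib

open scoped TensorProduct InnerProductSpace

noncomputable section

namespace QWhiteNoise

/-- The number `inv(π)` of inversions of `π`, i.e. of pairs `i < j` with `π i > π j`. -/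
def inversions {n : ℕ} (π : Equiv.Perm (Fin n)) : ℕ :=
  (Finset.univ.filter fun p : Fin n × Fin n => p.1 < p.2 ∧ π p.2 < π p.1).card

theorem inversions_symm {n : ℕ} (π : Equiv.Perm (Fin n)) : inversions π.symm = inversions π := by
  unfold inversions
  refine Finset.card_bij' (fun p _ => (π.symm p.2, π.symm p.1)) (fun p _ => (π p.2, π p.1))
    ?_ ?_ ?_ ?_ <;> simp +contextual

theorem inversions_comp_symm {n : ℕ} (σ τ : Equiv.Perm (Fin n)) :
    inversions (τ.symm.trans σ) = (Finset.univ.filter fun p : Fin n × Fin n =>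
      p.1 < p.2 ∧ ¬ (σ p.1 < σ p.2 ↔ τ p.1 < τ p.2)).card := by
  unfold inversions
  refine Finset.card_bij'
    (fun p _ => if τ.symm p.1 < τ.symm p.2 then (τ.symm p.1, τ.symm p.2)
      else (τ.symm p.2, τ.symm p.1))
    (fun p _ => if τ p.1 < τ p.2 then (τ p.1, τ p.2) else (τ p.2, τ p.1))
    ?_ ?_ ?_ ?_
  · rintro ⟨i, j⟩ h
    replace h := (Finset.mem_filter.1 h).2
    refine Finset.mem_filter.2 ⟨Finset.mem_univ _, ?_⟩
    simp only [Equiv.trans_apply] at h ⊢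
    split_ifs with h1
    · simp [h1, h.1, h.2.le]
    · have h2 : τ.symm j < τ.symm i :=
        lt_of_le_of_ne (not_lt.1 h1) (fun e => h.1.ne' (τ.symm.injective e))
      simp [h2, h.1.le, h.2]
  · rintro ⟨a, b⟩ h
    replace h := (Finset.mem_filter.1 h).2
    refine Finset.mem_filter.2 ⟨Finset.mem_univ _, ?_⟩
    simp only [Equiv.trans_apply] at h ⊢
    have hs : σ a ≠ σ b := fun e => h.1.ne (σ.injective e)
    have ht : τ a ≠ τ b := fun e => h.1.ne (τ.injective e)
    split_ifs with h1
    · simp only [h1, iff_true, not_lt] at h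
      simpa [h1] using lt_of_le_of_ne h.2 hs.symm
    · simp only [h1, iff_false, not_not] at h
      simpa [h.2] using lt_of_le_of_ne (not_lt.1 h1) ht.symm
  · rintro ⟨i, j⟩ h
    replace h := (Finset.mem_filter.1 h).2
    dsimp only
    split_ifs with h1 h2 h2
    · simp
    · simp [h.1] at h2
    · simp [not_lt.2 h.1.le] at h2
    · simp
  · rintro ⟨a, b⟩ h
    replace h := (Finset.mem_filter.1 h).2
    dsimp only
    split_ifs with h1 h2 h2
    · simp
    · simp [h.1] at h2
    · simp [not_lt.2 h.1.le] at h2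
    · simp

/-- Two permutations that order every pair of points alike are equal. -/
theorem perm_eq_of_order {n : ℕ} {σ τ : Equiv.Perm (Fin n)}
    (h : ∀ a b, a < b → (σ a < σ b ↔ τ a < τ b)) : σ = τ := by
  have key : inversions (τ.symm.trans σ) = 0 := by
    rw [inversions_comp_symm, Finset.card_eq_zero, Finset.filter_eq_empty_iff]
    rintro ⟨a, b⟩ - ⟨h1, h2⟩
    exact h2 (h a b h1)
  have hm : StrictMono (τ.symm.trans σ) := by
    intro i j hij
    rw [inversions, Finset.card_eq_zero, Finset.filter_eq_empty_iff] at key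
    have := key (Finset.mem_univ (i, j))
    simp only [not_and, not_lt] at this
    exact lt_of_le_of_ne (this hij) (fun e => hij.ne ((τ.symm.trans σ).injective e))
  have : (⇑(τ.symm.trans σ) : Fin n → Fin n) = id := by
    have := Subsingleton.elim (hm.orderIsoOfSurjective _ (τ.symm.trans σ).surjective)
      (OrderIso.refl (Fin n))
    funext i
    exact congrArg (fun e : Fin n ≃o Fin n => e i) this
  ext i
  have := congrFun this (τ i)
  simp at this
  rw [this]

theorem sum_fiber_nonneg {α β : Type*} [Fintype α] [DecidableEq β] (g : α → β) (x : α → ℝ) :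
    0 ≤ ∑ a, ∑ b, (if g a = g b then x a * x b else 0) := by
  have : ∀ a b, (if g a = g b then x a * x b else 0) =
      ∑ c ∈ Finset.univ.image g, (if g a = c then x a else 0) * (if g b = c then x b else 0) := by
    intro a b
    rw [Finset.sum_eq_single (g a)]
    · by_cases h : g a = g b
      · simp [h]
      · simp [h, Ne.symm h]
    · intro c _ hc
      simp [Ne.symm hc]
    · intro h; simp at h
  simp_rw [this]
  have : ∀ a, (∑ b, ∑ c ∈ Finset.univ.image g, (if g a = c then x a else 0) *
      (if g b = c then x b else 0)) = ∑ c ∈ Finset.univ.image g, (if g a = c then x a else 0) *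
      ∑ b, (if g b = c then x b else 0) := by
    intro a
    rw [Finset.sum_comm]
    simp_rw [Finset.mul_sum]
  simp_rw [this]
  rw [Finset.sum_comm]
  refine Finset.sum_nonneg fun c _ => ?_
  rw [← Finset.sum_mul]
  exact mul_self_nonneg _

/-- The kernel `q ^ inversions (σ τ⁻¹)` on the symmetric group is strictly positive definite. -/
theorem kernel_lower_bound {n : ℕ} {q : ℝ} (hq : |q| < 1) :
    ∃ c : ℝ, 0 < c ∧ ∀ v : Equiv.Perm (Fin n) → ℝ,
      c * ∑ σ, v σ ^ 2 ≤ ∑ σ, ∑ τ, q ^ inversions (τ.symm.trans σ) * (v σ * v τ) := by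
  classical
  set D : Finset (Fin n × Fin n) := Finset.univ.filter fun p => p.1 < p.2 with hD
  let e : Equiv.Perm (Fin n) → Fin n × Fin n → Prop := fun σ p => σ p.1 < σ p.2
  let s : Equiv.Perm (Fin n) → Fin n × Fin n → ℝ := fun σ p => if 0 ≤ q ∨ e σ p then 1 else -1
  have hK : ∀ σ τ, q ^ inversions (τ.symm.trans σ) = ∏ p ∈ D,
      ((1 - |q|) * (if e σ p = e τ p then 1 else 0) + |q| * (s σ p * s τ p)) := by
    intro σ τ
    rw [inversions_comp_symm, ← Finset.prod_const, ← Finset.filter_filter, Finset.prod_filter]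
    refine Finset.prod_congr rfl fun p _ => ?_
    by_cases h1 : e σ p <;> by_cases h2 : e τ p <;> by_cases h0 : 0 ≤ q <;>
      simp only [e] at h1 h2 <;> simp [s, e, h1, h2, h0, abs_of_nonneg, abs_of_neg, not_le.1]
  refine ⟨(1 - |q|) ^ D.card, pow_pos (by linarith) _, fun v => ?_⟩
  have hexp : ∀ σ τ, q ^ inversions (τ.symm.trans σ) * (v σ * v τ) = ∑ S ∈ D.powerset,
      ((1 - |q|) ^ S.card * |q| ^ (D \ S).card) *
        (if (fun p : S => e σ p) = (fun p : S => e τ p) then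
          ((∏ p ∈ D \ S, s σ p) * v σ) * ((∏ p ∈ D \ S, s τ p) * v τ) else 0) := by
    intro σ τ
    rw [hK, Finset.prod_add, Finset.sum_mul]
    refine Finset.sum_congr rfl fun S _ => ?_
    rw [Finset.prod_mul_distrib, Finset.prod_mul_distrib, Finset.prod_const, Finset.prod_const,
      Finset.prod_mul_distrib]
    by_cases h : (fun p : S => e σ p) = (fun p : S => e τ p)
    · rw [if_pos h, Finset.prod_eq_one]
      · ring
      · intro p hp
        rw [if_pos (congrFun h ⟨p, hp⟩)]
    · rw [if_neg h]
      have : ∃ p : S, ¬ (e σ p = e τ p) := by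
        by_contra hc
        push Not at hc
        exact h (funext hc)
      obtain ⟨p, hp⟩ := this
      rw [Finset.prod_eq_zero p.2 (by rw [if_neg hp])]
      ring
  simp_rw [hexp]
  have hswap : (∑ σ : Equiv.Perm (Fin n), ∑ τ : Equiv.Perm (Fin n), ∑ S ∈ D.powerset,
      ((1 - |q|) ^ S.card * |q| ^ (D \ S).card) *
        (if (fun p : S => e σ p) = (fun p : S => e τ p) then
          ((∏ p ∈ D \ S, s σ p) * v σ) * ((∏ p ∈ D \ S, s τ p) * v τ) else 0)) =
      ∑ S ∈ D.powerset, ((1 - |q|) ^ S.card * |q| ^ (D \ S).card) *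
        ∑ σ : Equiv.Perm (Fin n), ∑ τ : Equiv.Perm (Fin n),
        (if (fun p : S => e σ p) = (fun p : S => e τ p) then
          ((∏ p ∈ D \ S, s σ p) * v σ) * ((∏ p ∈ D \ S, s τ p) * v τ) else 0) := by
    simp_rw [Finset.mul_sum]
    rw [Finset.sum_congr rfl fun σ _ => Finset.sum_comm]
    rw [Finset.sum_comm]
  rw [hswap]
  have hnn : ∀ S ∈ D.powerset, 0 ≤ ((1 - |q|) ^ S.card * |q| ^ (D \ S).card) *
        ∑ σ : Equiv.Perm (Fin n), ∑ τ : Equiv.Perm (Fin n),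
        (if (fun p : S => e σ p) = (fun p : S => e τ p) then
          ((∏ p ∈ D \ S, s σ p) * v σ) * ((∏ p ∈ D \ S, s τ p) * v τ) else 0) := by
    intro S _
    refine mul_nonneg (mul_nonneg (pow_nonneg (by linarith) _) (pow_nonneg (abs_nonneg _) _)) ?_
    exact sum_fiber_nonneg (fun σ => fun p : S => e σ p) (fun σ => (∏ p ∈ D \ S, s σ p) * v σ)
  refine le_trans (le_of_eq ?_) (Finset.single_le_sum hnn (Finset.mem_powerset_self D))
  rw [Finset.sdiff_self, Finset.card_empty, pow_zero, mul_one]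
  congr 1
  refine Finset.sum_congr rfl fun σ _ => ?_
  rw [Finset.sum_eq_single σ]
  · simp [sq]
  · intro τ _ hτ
    rw [if_neg]
    intro h
    refine hτ (perm_eq_of_order fun a b hab => ?_)
    have := congrFun h ⟨(a, b), by simp [hD, hab]⟩
    exact (iff_of_eq this).symm
  · intro h; simp at h

variable {H : Type*} [NormedAddCommGroup H] [InnerProductSpace ℝ H]

/-- The standard scalar product of the algebraic tensor power:
`(f₁ ⊗ ⋯ ⊗ fₙ, g₁ ⊗ ⋯ ⊗ gₙ) = ∏ i, (fᵢ, gᵢ)`. -/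
def tensorInner (H : Type*) [NormedAddCommGroup H] [InnerProductSpace ℝ H] (n : ℕ) :
    ⨂[ℝ]^n H →ₗ[ℝ] ⨂[ℝ]^n H →ₗ[ℝ] ℝ :=
  TensorPower.pairingDual ℝ H n ∘ₗ PiTensorProduct.map (fun _ => innerₗ H)

theorem tensorInner_tprod {n : ℕ} (f g : Fin n → H) :
    tensorInner H n (PiTensorProduct.tprod ℝ f) (PiTensorProduct.tprod ℝ g) =
      ∏ i, ⟪f i, g i⟫_ℝ := by
  simp [tensorInner]

/-- The operator `P_q^{(n)} f₁ ⊗ ⋯ ⊗ fₙ = ∑ π, q ^ inv(π) f_{π(1)} ⊗ ⋯ ⊗ f_{π(n)}` on the algebraic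
tensor power (see `qSymmetrizer_tprod`). -/
def qSymmetrizer (q : ℝ) (H : Type*) [NormedAddCommGroup H] [InnerProductSpace ℝ H] (n : ℕ) :
    ⨂[ℝ]^n H →ₗ[ℝ] ⨂[ℝ]^n H :=
  ∑ π : Equiv.Perm (Fin n),
    q ^ inversions π • (PiTensorProduct.reindex ℝ (fun _ : Fin n => H) π.symm).toLinearMap

theorem qSymmetrizer_tprod (q : ℝ) {n : ℕ} (f : Fin n → H) :
    qSymmetrizer q H n (PiTensorProduct.tprod ℝ f) =
      ∑ π : Equiv.Perm (Fin n), q ^ inversions π • PiTensorProduct.tprod ℝ (fun i => f (π i)) := by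
  simp [qSymmetrizer, LinearMap.sum_apply]

/-- The `q`-deformed scalar product `(P_q^{(n)} x, y)` of the algebraic tensor power. -/
def qForm (q : ℝ) (H : Type*) [NormedAddCommGroup H] [InnerProductSpace ℝ H] (n : ℕ) :
    ⨂[ℝ]^n H →ₗ[ℝ] ⨂[ℝ]^n H →ₗ[ℝ] ℝ :=
  tensorInner H n ∘ₗ qSymmetrizer q H n

theorem qForm_tprod (q : ℝ) {n : ℕ} (f g : Fin n → H) :
    qForm q H n (PiTensorProduct.tprod ℝ f) (PiTensorProduct.tprod ℝ g) =
      ∑ π : Equiv.Perm (Fin n), q ^ inversions π * ∏ i, ⟪f (π i), g i⟫_ℝ := by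
  simp [qForm, qSymmetrizer_tprod, LinearMap.sum_apply, tensorInner_tprod]

theorem qForm_symm (q : ℝ) {n : ℕ} (x y : ⨂[ℝ]^n H) :
    qForm q H n x y = qForm q H n y x := by
  have : qForm q H n = (qForm q H n).flip := by
    ext f g
    simp only [LinearMap.compMultilinearMap_apply, LinearMap.flip_apply, qForm_tprod]
    rw [← Equiv.sum_comp (Equiv.inv (Equiv.Perm (Fin n)))]
    refine Finset.sum_congr rfl fun π _ => ?_
    rw [Equiv.inv_apply, show inversions π⁻¹ = inversions π from inversions_symm π, ← Equiv.prod_comp π]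
    congr 1
    refine Finset.prod_congr rfl fun i _ => ?_
    rw [Equiv.Perm.inv_def, Equiv.symm_apply_apply, real_inner_comm]
  exact LinearMap.congr_fun₂ this x y

theorem exists_finite_submodule {n : ℕ} (x : ⨂[ℝ]^n H) :
    ∃ S : Submodule ℝ H, FiniteDimensional ℝ S ∧
      x ∈ LinearMap.range (PiTensorProduct.map (fun _ : Fin n => S.subtype)) := by
  have mono : ∀ {S T : Submodule ℝ H}, S ≤ T →
      LinearMap.range (PiTensorProduct.map (fun _ : Fin n => S.subtype)) ≤
      LinearMap.range (PiTensorProduct.map (fun _ : Fin n => T.subtype)) := by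
    rintro S T h _ ⟨y, rfl⟩
    refine ⟨PiTensorProduct.map (fun _ => Submodule.inclusion h) y, ?_⟩
    rw [← LinearMap.comp_apply, ← PiTensorProduct.map_comp]
    rfl
  induction x using PiTensorProduct.induction_on with
  | smul_tprod r f =>
    refine ⟨Submodule.span ℝ (Set.range f),
      FiniteDimensional.span_of_finite ℝ (Set.finite_range f), ?_⟩
    refine Submodule.smul_mem _ _ ⟨PiTensorProduct.tprod ℝ
      (fun i => ⟨f i, Submodule.subset_span ⟨i, rfl⟩⟩), ?_⟩
    simp
  | add x y hx hy =>
    obtain ⟨S, hS, hx⟩ := hx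
    obtain ⟨T, hT, hy⟩ := hy
    exact ⟨S ⊔ T, inferInstance, add_mem (mono le_sup_left hx) (mono le_sup_right hy)⟩

theorem exists_orthonormal_expansion {n : ℕ} (x : ⨂[ℝ]^n H) :
    ∃ (d : ℕ) (b : Fin d → H) (c : (Fin n → Fin d) → ℝ), Orthonormal ℝ b ∧
      x = ∑ p, c p • PiTensorProduct.tprod ℝ (fun i => b (p i)) := by
  obtain ⟨S, hS, y, rfl⟩ := exists_finite_submodule x
  let e := stdOrthonormalBasis ℝ S
  let B := Basis.piTensorProduct (fun _ : Fin n => e.toBasis)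
  refine ⟨_, fun j => (e j : H), fun p => B.repr y p,
    e.orthonormal.comp_linearIsometry S.subtypeₗᵢ, ?_⟩
  conv_lhs => rw [← B.sum_repr y]
  simp [map_sum, B, Basis.piTensorProduct_apply]

/-- Strict positivity of `P_q^{(n)}`. -/
theorem qForm_pos {q : ℝ} (hq : |q| < 1) {n : ℕ} (x : ⨂[ℝ]^n H) :
    0 ≤ qForm q H n x x ∧ (qForm q H n x x = 0 → x = 0) := by
  obtain ⟨d, b, c, hb, rfl⟩ := exists_orthonormal_expansion x
  obtain ⟨k, hk, hker⟩ := kernel_lower_bound (n := n) hq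
  set x := ∑ p, c p • PiTensorProduct.tprod ℝ (fun i => b (p i)) with hx
  have h1 : qForm q H n x x = ∑ π : Equiv.Perm (Fin n), q ^ inversions π * ∑ p, c p * c (p ∘ π) := by
    have : ∀ p p', qForm q H n (PiTensorProduct.tprod ℝ (fun i => b (p i)))
        (PiTensorProduct.tprod ℝ (fun i => b (p' i))) =
        ∑ π : Equiv.Perm (Fin n), q ^ inversions π * (if p' = p ∘ π then 1 else 0) := by
      intro p p'
      rw [qForm_tprod]
      refine Finset.sum_congr rfl fun π _ => ?_
      congr 1
      simp_rw [orthonormal_iff_ite.1 hb]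
      rw [Finset.prod_ite_zero]
      simp [funext_iff, eq_comm]
    simp only [hx, map_sum, map_smul, LinearMap.sum_apply, LinearMap.smul_apply, this,
      smul_eq_mul, Finset.mul_sum]
    rw [Finset.sum_comm, Finset.sum_congr rfl fun p _ => Finset.sum_comm, Finset.sum_comm]
    refine Finset.sum_congr rfl fun π _ => ?_
    refine Finset.sum_congr rfl fun p _ => ?_
    rw [Finset.sum_eq_single (p ∘ π)]
    · simp; ring
    · intro p' _ h; simp [h]
    · simp
  have h2 : (Nat.factorial n : ℝ) * qForm q H n x x = ∑ p : Fin n → Fin d,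
      ∑ σ : Equiv.Perm (Fin n), ∑ τ : Equiv.Perm (Fin n),
        q ^ inversions (τ.symm.trans σ) * (c (p ∘ σ.symm) * c (p ∘ τ.symm)) := by
    have h3 : ∀ σ : Equiv.Perm (Fin n), qForm q H n x x = ∑ τ : Equiv.Perm (Fin n),
        ∑ p : Fin n → Fin d,
        q ^ inversions (τ.symm.trans σ) * (c (p ∘ σ.symm) * c (p ∘ τ.symm)) := by
      intro σ
      rw [h1, ← ((Equiv.inv _).trans (Equiv.mulLeft σ)).sum_comp]
      refine Finset.sum_congr rfl fun τ _ => ?_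
      rw [Finset.mul_sum, ← (Equiv.arrowCongr σ (Equiv.refl (Fin d))).sum_comp]
      refine Finset.sum_congr rfl fun p _ => ?_
      congr 2
      congr 1
      ext i
      simp
    rw [Finset.sum_comm]
    rw [Finset.sum_congr rfl fun σ _ => Finset.sum_comm, ← Finset.sum_congr rfl fun σ _ => h3 σ]
    simp [Fintype.card_perm]
  have h4 : k * ∑ p : Fin n → Fin d, ∑ σ : Equiv.Perm (Fin n), c (p ∘ σ.symm) ^ 2 ≤
      (Nat.factorial n : ℝ) * qForm q H n x x := by
    rw [h2, Finset.mul_sum]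
    exact Finset.sum_le_sum fun p _ => hker fun σ => c (p ∘ σ.symm)
  have hf : (0 : ℝ) < Nat.factorial n := by exact_mod_cast Nat.factorial_pos n
  have h5 : 0 ≤ ∑ p : Fin n → Fin d, ∑ σ : Equiv.Perm (Fin n), c (p ∘ σ.symm) ^ 2 := by positivity
  refine ⟨nonneg_of_mul_nonneg_right ((mul_nonneg hk.le h5).trans h4) hf, fun h0 => ?_⟩
  rw [h0, mul_zero] at h4
  have h6 := le_antisymm (nonpos_of_mul_nonpos_right h4 hk) h5
  rw [Finset.sum_eq_zero_iff_of_nonneg (fun _ _ => by positivity)] at h6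
  rw [hx]
  refine Finset.sum_eq_zero fun p hp => ?_
  have h7 := h6 p hp
  rw [Finset.sum_eq_zero_iff_of_nonneg (fun _ _ => by positivity)] at h7
  have h8 := h7 (Equiv.refl _) (Finset.mem_univ _)
  have h9 : c p = 0 := by simpa using h8
  rw [h9, zero_smul]

theorem tensor_induction {p : TensorAlgebra ℝ H → Prop}
    (tprod : ∀ n (f : Fin n → H), p (TensorAlgebra.tprod ℝ H n f))
    (add : ∀ x y, p x → p y → p (x + y)) (smul : ∀ (r : ℝ) x, p x → p (r • x))
    (x : TensorAlgebra ℝ H) : p x := by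
  rw [← TensorAlgebra.ofDirectSum_toDirectSum x]
  generalize TensorAlgebra.toDirectSum x = y
  induction y using DirectSum.induction_on with
  | zero => simpa using smul 0 _ (tprod 0 Fin.elim0)
  | of n z =>
    induction z using PiTensorProduct.induction_on with
    | smul_tprod r f =>
      rw [← DirectSum.lof_eq_of ℝ, map_smul, map_smul, DirectSum.lof_eq_of,
        TensorAlgebra.ofDirectSum_of_tprod]
      exact smul _ _ (tprod n f)
    | add z w hz hw => rw [map_add, map_add]; exact add _ _ hz hw
  | add y z hy hz => rw [map_add]; exact add _ _ hy hz

theorem ι_mul_tprod (f : H) {n : ℕ} (g : Fin n → H) :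
    TensorAlgebra.ι ℝ f * TensorAlgebra.tprod ℝ H n g =
      TensorAlgebra.tprod ℝ H (n + 1) (Fin.cons f g) := by
  simp [TensorAlgebra.tprod_apply, List.ofFn_succ]

/-- The scalar product of `⨁ₙ ℱ_q^{(n)}` on finite algebraic vectors, the tensor algebra being
identified with `⨁ₙ ⨂ⁿ H`: the sum over `n` of the `q`-deformed scalar products of the
components of degree `n`. -/
def fockForm (q : ℝ) (H : Type*) [NormedAddCommGroup H] [InnerProductSpace ℝ H] :
    TensorAlgebra ℝ H →ₗ[ℝ] TensorAlgebra ℝ H →ₗ[ℝ] ℝ :=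
  (DirectSum.toModule ℝ ℕ _ fun n =>
      (qForm q H n).compl₂ (DirectSum.component ℝ ℕ (fun n => ⨂[ℝ]^n H) n)).compl₁₂
    (TensorAlgebra.equivDirectSum (R := ℝ) (M := H)).toLinearMap
    (TensorAlgebra.equivDirectSum (R := ℝ) (M := H)).toLinearMap

theorem fockForm_apply (q : ℝ) (x y : TensorAlgebra ℝ H) (s : Finset ℕ)
    (hs : ∀ n, n ∉ s → TensorAlgebra.toDirectSum x n = 0) :
    fockForm q H x y = ∑ n ∈ s,
      qForm q H n (TensorAlgebra.toDirectSum x n) (TensorAlgebra.toDirectSum y n) := by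
  have hx : TensorAlgebra.toDirectSum x = ∑ n ∈ s,
      DirectSum.lof ℝ ℕ (fun n => ⨂[ℝ]^n H) n (TensorAlgebra.toDirectSum x n) := by
    refine DirectSum.ext_component ℝ fun m => ?_
    rw [map_sum]
    by_cases hm : m ∈ s
    · rw [Finset.sum_eq_single m]
      · rw [DirectSum.component.lof_self]; rfl
      · intro n _ hn
        rw [DirectSum.component.of, dif_neg hn]
      · exact fun h => absurd hm h
    · rw [Finset.sum_eq_zero]
      · exact hs m hm
      · intro n hn
        rw [DirectSum.component.of, dif_neg (fun e : n = m => hm (e ▸ hn))]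
  simp only [fockForm, LinearMap.compl₁₂_apply, AlgEquiv.toLinearMap_apply,
    TensorAlgebra.equivDirectSum_apply]
  conv_lhs => rw [hx]
  rw [map_sum, LinearMap.sum_apply]
  refine Finset.sum_congr rfl fun n _ => ?_
  rw [DirectSum.toModule_lof]
  rfl

theorem fockForm_pos {q : ℝ} (hq : |q| < 1) (x : TensorAlgebra ℝ H) :
    0 ≤ fockForm q H x x ∧ (fockForm q H x x = 0 → x = 0) := by
  classical
  have h := fockForm_apply q x x (DFinsupp.support (TensorAlgebra.toDirectSum x))
    (fun n hn => DFinsupp.notMem_support_iff.1 hn)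
  refine ⟨h ▸ Finset.sum_nonneg fun n _ => (qForm_pos hq _).1, fun h0 => ?_⟩
  rw [h, Finset.sum_eq_zero_iff_of_nonneg fun n _ => (qForm_pos hq _).1] at h0
  have : TensorAlgebra.toDirectSum x = 0 := by
    refine DFinsupp.ext fun n => ?_
    by_cases hn : n ∈ DFinsupp.support (TensorAlgebra.toDirectSum x)
    · exact (qForm_pos hq _).2 (h0 n hn)
    · exact DFinsupp.notMem_support_iff.1 hn
  rw [← TensorAlgebra.ofDirectSum_toDirectSum x, this, map_zero]

theorem fockForm_tprod (q : ℝ) {n : ℕ} (f g : Fin n → H) :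
    fockForm q H (TensorAlgebra.tprod ℝ H n f) (TensorAlgebra.tprod ℝ H n g) =
      ∑ π : Equiv.Perm (Fin n), q ^ inversions π * ∏ i, ⟪f (π i), g i⟫_ℝ := by
  simp only [fockForm, LinearMap.compl₁₂_apply, AlgEquiv.toLinearMap_apply,
    TensorAlgebra.equivDirectSum_apply, TensorAlgebra.toDirectSum_tensorPower_tprod]
  rw [← DirectSum.lof_eq_of ℝ, DirectSum.toModule_lof, LinearMap.compl₂_apply,
    ← DirectSum.lof_eq_of ℝ, DirectSum.component.lof_self, qForm_tprod]

theorem fockForm_tprod_ne (q : ℝ) {n m : ℕ} (h : n ≠ m) (f : Fin n → H) (g : Fin m → H) :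
    fockForm q H (TensorAlgebra.tprod ℝ H n f) (TensorAlgebra.tprod ℝ H m g) = 0 := by
  simp only [fockForm, LinearMap.compl₁₂_apply, AlgEquiv.toLinearMap_apply,
    TensorAlgebra.equivDirectSum_apply, TensorAlgebra.toDirectSum_tensorPower_tprod]
  rw [← DirectSum.lof_eq_of ℝ, DirectSum.toModule_lof, LinearMap.compl₂_apply,
    ← DirectSum.lof_eq_of ℝ, DirectSum.component.of, dif_neg h.symm, map_zero]

theorem fockForm_symm (q : ℝ) (x y : TensorAlgebra ℝ H) :
    fockForm q H x y = fockForm q H y x := by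
  induction x using tensor_induction with
  | add x x' h h' => simp only [map_add, LinearMap.add_apply, h, h']
  | smul r x h => simp only [map_smul, LinearMap.smul_apply, h]
  | tprod n f =>
    induction y using tensor_induction with
    | add x x' h h' => simp only [map_add, LinearMap.add_apply, h, h']
    | smul r x h => simp only [map_smul, LinearMap.smul_apply, h]
    | tprod m g =>
      by_cases h : n = m
      · subst h
        have := qForm_symm q (PiTensorProduct.tprod ℝ f) (PiTensorProduct.tprod ℝ g)
        rwa [qForm_tprod, qForm_tprod, ← fockForm_tprod, ← fockForm_tprod] at this
      · rw [fockForm_tprod_ne q h, fockForm_tprod_ne q (Ne.symm h)]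

/-- The permutation `0 ↦ j`, `i + 1 ↦ j.succAbove (ρ i)`. -/
def consPerm {n : ℕ} (p : Fin (n + 1) × Equiv.Perm (Fin n)) : Equiv.Perm (Fin (n + 1)) :=
  (Equiv.Perm.decomposeFin.symm (0, p.2)).trans p.1.cycleRange.symm

theorem consPerm_zero {n : ℕ} (p : Fin (n + 1) × Equiv.Perm (Fin n)) : consPerm p 0 = p.1 := by
  simp [consPerm]

theorem consPerm_succ {n : ℕ} (p : Fin (n + 1) × Equiv.Perm (Fin n)) (i : Fin n) :
    consPerm p i.succ = p.1.succAbove (p.2 i) := by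
  simp [consPerm]

theorem consPerm_bijective {n : ℕ} : Function.Bijective (consPerm (n := n)) := by
  rw [Fintype.bijective_iff_injective_and_card]
  constructor
  · rintro ⟨j, ρ⟩ ⟨j', ρ'⟩ h
    have h0 : j = j' := by
      simpa [consPerm_zero] using congrArg (fun e : Equiv.Perm (Fin (n + 1)) => e 0) h
    subst h0
    congr 1
    ext i
    have := congrArg (fun e : Equiv.Perm (Fin (n + 1)) => e i.succ) h
    simp only [consPerm_succ] at this
    rw [Fin.succAbove_right_injective this]
  · simp [Fintype.card_perm, Nat.factorial_succ]

theorem inversions_consPerm {n : ℕ} (p : Fin (n + 1) × Equiv.Perm (Fin n)) :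
    inversions (consPerm p) = p.1 + inversions p.2 := by
  unfold inversions
  rw [Finset.card_filter, Finset.card_filter, Fintype.sum_prod_type, Fintype.sum_prod_type,
    Fin.sum_univ_succ]
  simp_rw [Fin.sum_univ_succ, consPerm_zero, consPerm_succ]
  simp only [lt_self_iff_false, false_and, if_false, zero_add, Fin.succ_pos, true_and,
    Fin.not_lt_zero, Fin.succ_lt_succ_iff, Fin.succAbove_lt_succAbove_iff]
  congr 1
  rw [Equiv.sum_comp p.2 (fun c => if p.1.succAbove c < p.1 then (1 : ℕ) else 0), ← Finset.card_filter]
  simp_rw [Fin.succAbove_lt_iff_castSucc_lt]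
  have : (Finset.univ.filter fun c : Fin n => c.castSucc < p.1).map
      ⟨Fin.val, Fin.val_injective⟩ = Finset.range p.1 := by
    ext m
    simp only [Finset.mem_map, Finset.mem_filter, Finset.mem_univ, true_and,
      Function.Embedding.coeFn_mk, Finset.mem_range]
    constructor
    · rintro ⟨c, hc, rfl⟩; exact hc
    · intro hm; exact ⟨⟨m, by have := p.1.2; omega⟩, hm, rfl⟩
  rw [← Finset.card_map, this, Finset.card_range]

theorem fockForm_tprod' (q : ℝ) {n : ℕ} (f g : Fin n → H) :
    fockForm q H (TensorAlgebra.tprod ℝ H n f) (TensorAlgebra.tprod ℝ H n g) =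
      ∑ π : Equiv.Perm (Fin n), q ^ inversions π * ∏ i, ⟪f i, g (π i)⟫_ℝ := by
  rw [fockForm_symm, fockForm_tprod]
  simp_rw [real_inner_comm]

/-- Pairing of `φ` with the `i`-th factor, which is removed. -/
def contractAt (φ : H) {n : ℕ} (i : Fin (n + 1)) : ⨂[ℝ]^(n + 1) H →ₗ[ℝ] ⨂[ℝ]^n H :=
  PiTensorProduct.lift
    (LinearMap.uncurryMid i ((innerₗ H φ).smulRight (PiTensorProduct.tprod ℝ)))

theorem contractAt_tprod (φ : H) {n : ℕ} (i : Fin (n + 1)) (f : Fin (n + 1) → H) :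
    contractAt φ i (PiTensorProduct.tprod ℝ f) =
      ⟪φ, f i⟫_ℝ • PiTensorProduct.tprod ℝ (i.removeNth f) := by
  simp [contractAt]

/-- The annihilation operator on tensors of degree `n`:
`f₁ ⊗ ⋯ ⊗ fₙ ↦ ∑ i, q ^ (i - 1) (φ, fᵢ) f₁ ⊗ ⋯ (fᵢ removed) ⋯ ⊗ fₙ` (indices start at `0` below). -/
def annihilationLevel (q : ℝ) (φ : H) : (n : ℕ) → ⨂[ℝ]^n H →ₗ[ℝ] TensorAlgebra ℝ H
  | 0 => 0
  | n + 1 => TensorPower.toTensorAlgebra ∘ₗ ∑ i : Fin (n + 1), q ^ (i : ℕ) • contractAt φ i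

/-- The annihilation operator on finite algebraic vectors. -/
def annihilationAlg (q : ℝ) (φ : H) : TensorAlgebra ℝ H →ₗ[ℝ] TensorAlgebra ℝ H :=
  DirectSum.toModule ℝ ℕ _ (annihilationLevel q φ) ∘ₗ
    (TensorAlgebra.equivDirectSum (R := ℝ) (M := H)).toLinearMap

theorem annihilationAlg_tprod_zero (q : ℝ) (φ : H) (f : Fin 0 → H) :
    annihilationAlg q φ (TensorAlgebra.tprod ℝ H 0 f) = 0 := by
  simp only [annihilationAlg, LinearMap.comp_apply, AlgEquiv.toLinearMap_apply,
    TensorAlgebra.equivDirectSum_apply, TensorAlgebra.toDirectSum_tensorPower_tprod]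
  rw [← DirectSum.lof_eq_of ℝ, DirectSum.toModule_lof]
  rfl

theorem annihilationAlg_tprod (q : ℝ) (φ : H) {n : ℕ} (f : Fin (n + 1) → H) :
    annihilationAlg q φ (TensorAlgebra.tprod ℝ H (n + 1) f) =
      ∑ i : Fin (n + 1), (q ^ (i : ℕ) * ⟪φ, f i⟫_ℝ) •
        TensorAlgebra.tprod ℝ H n (i.removeNth f) := by
  simp only [annihilationAlg, LinearMap.comp_apply, AlgEquiv.toLinearMap_apply,
    TensorAlgebra.equivDirectSum_apply, TensorAlgebra.toDirectSum_tensorPower_tprod]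
  rw [← DirectSum.lof_eq_of ℝ, DirectSum.toModule_lof]
  simp only [annihilationLevel, LinearMap.comp_apply, LinearMap.sum_apply, LinearMap.smul_apply,
    contractAt_tprod, map_sum, map_smul, TensorPower.toTensorAlgebra_tprod, mul_smul]

theorem annihilationAlg_ι_mul (q : ℝ) (φ ψ : H) (x : TensorAlgebra ℝ H) :
    annihilationAlg q φ (TensorAlgebra.ι ℝ ψ * x) =
      ⟪φ, ψ⟫_ℝ • x + q • (TensorAlgebra.ι ℝ ψ * annihilationAlg q φ x) := by
  induction x using tensor_induction with
  | add x y hx hy => simp only [mul_add, map_add, smul_add, hx, hy]; abel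
  | smul r x hx =>
    simp only [mul_smul_comm, map_smul, hx, smul_add]
    rw [smul_comm r, smul_comm r q]
  | tprod n f =>
    rw [ι_mul_tprod, annihilationAlg_tprod, Fin.sum_univ_succ]
    congr 1
    · simp [-TensorAlgebra.tprod_apply]
    · cases n with
      | zero => simp [annihilationAlg_tprod_zero, -TensorAlgebra.tprod_apply]
      | succ n =>
        rw [annihilationAlg_tprod, Finset.mul_sum, Finset.smul_sum]
        refine Finset.sum_congr rfl fun i _ => ?_
        rw [mul_smul_comm, ι_mul_tprod, smul_smul, Fin.val_succ, pow_succ, Fin.cons_succ]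
        congr 1
        · ring
        · congr 1
          ext k
          refine Fin.cases ?_ (fun k => ?_) k <;> simp [Fin.removeNth]

theorem fockForm_ι_mul (q : ℝ) (φ : H) (x y : TensorAlgebra ℝ H) :
    fockForm q H (TensorAlgebra.ι ℝ φ * x) y = fockForm q H x (annihilationAlg q φ y) := by
  induction x using tensor_induction with
  | add x x' h h' => simp only [mul_add, map_add, LinearMap.add_apply, h, h']
  | smul r x h => simp only [mul_smul_comm, map_smul, LinearMap.smul_apply, h]
  | tprod n f =>
    induction y using tensor_induction with
    | add x x' h h' => simp only [map_add, h, h']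
    | smul r x h => simp only [map_smul, h]
    | tprod m g =>
      rw [ι_mul_tprod]
      cases m with
      | zero =>
        rw [annihilationAlg_tprod_zero, map_zero, fockForm_tprod_ne q (Nat.succ_ne_zero n)]
      | succ m =>
        rw [annihilationAlg_tprod, map_sum]
        simp_rw [map_smul]
        by_cases h : n = m
        · subst h
          rw [fockForm_tprod', ← (Equiv.ofBijective _ consPerm_bijective).sum_comp,
            Fintype.sum_prod_type]
          refine Finset.sum_congr rfl fun j _ => ?_
          rw [fockForm_tprod', smul_eq_mul, Finset.mul_sum]
          refine Finset.sum_congr rfl fun ρ _ => ?_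
          rw [Equiv.ofBijective_apply, inversions_consPerm, Fin.prod_univ_succ, consPerm_zero, pow_add]
          simp only [consPerm_succ, Fin.cons_zero, Fin.cons_succ, Fin.removeNth]
          ring
        · rw [fockForm_tprod_ne q (by simpa using h), Finset.sum_eq_zero]
          intro j _
          rw [fockForm_tprod_ne q h, smul_zero]

/-- The finite algebraic vectors `⨁ₙ ⨂ⁿ H` with the scalar product of the `q`-Fock space. -/
def AlgFock (_q : Set.Ioo (-1 : ℝ) 1) (H : Type*) [NormedAddCommGroup H] [InnerProductSpace ℝ H] :
    Type _ :=
  TensorAlgebra ℝ H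

instance (q : Set.Ioo (-1 : ℝ) 1) : Ring (AlgFock q H) := inferInstanceAs (Ring (TensorAlgebra ℝ H))

instance (q : Set.Ioo (-1 : ℝ) 1) : Algebra ℝ (AlgFock q H) :=
  inferInstanceAs (Algebra ℝ (TensorAlgebra ℝ H))

theorem abs_lt_one (q : Set.Ioo (-1 : ℝ) 1) : |(q : ℝ)| < 1 := abs_lt.2 q.2

/-- The `q`-deformed scalar product is positive definite. -/
@[reducible]
def fockCore (q : Set.Ioo (-1 : ℝ) 1) (H : Type*) [NormedAddCommGroup H] [InnerProductSpace ℝ H] :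
    InnerProductSpace.Core ℝ (AlgFock q H) where
  inner x y := fockForm (q : ℝ) H x y
  conj_inner_symm x y := fockForm_symm (q : ℝ) y x
  re_inner_nonneg x := (fockForm_pos (abs_lt_one q) x).1
  add_left x y z := LinearMap.map_add₂ (fockForm (q : ℝ) H) x y z
  smul_left x y r := LinearMap.map_smul₂ (fockForm (q : ℝ) H) r x y
  definite x := (fockForm_pos (abs_lt_one q) x).2

instance (q : Set.Ioo (-1 : ℝ) 1) : NormedAddCommGroup (AlgFock q H) :=
  (fockCore q H).toNormedAddCommGroup

instance (q : Set.Ioo (-1 : ℝ) 1) : InnerProductSpace ℝ (AlgFock q H) :=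
  InnerProductSpace.ofCore (fockCore q H).toCore

variable (q : Set.Ioo (-1 : ℝ) 1)

theorem algFock_inner (x y : AlgFock q H) : ⟪x, y⟫_ℝ = fockForm (q : ℝ) H x y := rfl

/-- The creation operator `x ↦ φ ⊗ x` on finite algebraic vectors. -/
def algCreation (φ : H) : AlgFock q H →ₗ[ℝ] AlgFock q H :=
  LinearMap.mulLeft ℝ (TensorAlgebra.ι ℝ φ : TensorAlgebra ℝ H)

/-- The annihilation operator on finite algebraic vectors. -/
def algAnnihilation (φ : H) : AlgFock q H →ₗ[ℝ] AlgFock q H :=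
  annihilationAlg (q : ℝ) φ

theorem algCreation_adjoint (φ : H) (x y : AlgFock q H) :
    ⟪algCreation q φ x, y⟫_ℝ = ⟪x, algAnnihilation q φ y⟫_ℝ :=
  fockForm_ι_mul (q : ℝ) φ x y

theorem algAnnihilation_creation (φ ψ : H) (x : AlgFock q H) :
    algAnnihilation q φ (algCreation q ψ x) =
      ⟪φ, ψ⟫_ℝ • x + (q : ℝ) • algCreation q ψ (algAnnihilation q φ x) :=
  annihilationAlg_ι_mul (q : ℝ) φ ψ x

theorem norm_sq_algCreation (φ : H) (x : AlgFock q H) :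
    ‖algCreation q φ x‖ ^ 2 = ‖φ‖ ^ 2 * ‖x‖ ^ 2 + q * ‖algAnnihilation q φ x‖ ^ 2 := by
  rw [← real_inner_self_eq_norm_sq, algCreation_adjoint, algAnnihilation_creation, inner_add_right,
    inner_smul_right, inner_smul_right, ← real_inner_comm x (algCreation q φ _),
    algCreation_adjoint]
  simp only [real_inner_self_eq_norm_sq]

/-- Tensors of degree at most `N`. -/
def degreeLE (H : Type*) [NormedAddCommGroup H] [InnerProductSpace ℝ H] (N : ℕ) :
    Submodule ℝ (TensorAlgebra ℝ H) :=
  Submodule.span ℝ {x | ∃ n ≤ N, ∃ f : Fin n → H, x = TensorAlgebra.tprod ℝ H n f}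

theorem annihilation_degree {N : ℕ} (r : ℝ) (φ : H) {x : TensorAlgebra ℝ H}
    (hx : x ∈ degreeLE H N) :
    (N = 0 → annihilationAlg r φ x = 0) ∧ annihilationAlg r φ x ∈ degreeLE H (N - 1) := by
  induction hx using Submodule.span_induction with
  | mem x hx =>
    obtain ⟨n, hn, f, rfl⟩ := hx
    cases n with
    | zero => rw [annihilationAlg_tprod_zero]; exact ⟨fun _ => rfl, zero_mem _⟩
    | succ n =>
      refine ⟨fun h => by omega, ?_⟩
      rw [annihilationAlg_tprod]
      refine Submodule.sum_mem _ fun i _ => Submodule.smul_mem _ _ (Submodule.subset_span ?_)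
      exact ⟨n, by omega, _, rfl⟩
  | zero => simp
  | add x y _ _ hx hy =>
    rw [map_add]
    exact ⟨fun h => by rw [hx.1 h, hy.1 h, add_zero], add_mem hx.2 hy.2⟩
  | smul c x _ hx =>
    rw [map_smul]
    exact ⟨fun h => by rw [hx.1 h, smul_zero], Submodule.smul_mem _ _ hx.2⟩

theorem exists_degree (x : TensorAlgebra ℝ H) : ∃ N, x ∈ degreeLE H N := by
  have mono : ∀ {N M : ℕ}, N ≤ M → degreeLE H N ≤ degreeLE H M := fun h =>
    Submodule.span_mono fun _ ⟨n, hn, f, hf⟩ => ⟨n, hn.trans h, f, hf⟩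
  induction x using tensor_induction with
  | tprod n f => exact ⟨n, Submodule.subset_span ⟨n, le_rfl, f, rfl⟩⟩
  | add x y hx hy =>
    obtain ⟨N, hx⟩ := hx
    obtain ⟨M, hy⟩ := hy
    exact ⟨max N M, add_mem (mono (le_max_left _ _) hx) (mono (le_max_right _ _) hy)⟩
  | smul r x hx =>
    obtain ⟨N, hx⟩ := hx
    exact ⟨N, Submodule.smul_mem _ _ hx⟩

/-- A common bound for the norms of `a⁺(φ)` and `a⁻(φ)`. -/
def opBound (φ : H) : ℝ := Real.sqrt (‖φ‖ ^ 2 / (1 - |(q : ℝ)|))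

theorem opBound_sq (φ : H) : opBound q φ ^ 2 * (1 - |(q : ℝ)|) = ‖φ‖ ^ 2 := by
  have h : 0 < 1 - |(q : ℝ)| := by linarith [abs_lt_one q]
  rw [opBound, Real.sq_sqrt (by positivity), div_mul_cancel₀ _ h.ne']

theorem norm_annihilation_le_of_creation (φ : H) (x : AlgFock q H)
    (h : ‖algCreation q φ (algAnnihilation q φ x)‖ ≤ opBound q φ * ‖algAnnihilation q φ x‖) :
    ‖algAnnihilation q φ x‖ ≤ opBound q φ * ‖x‖ := by
  have h1 : ‖algAnnihilation q φ x‖ ^ 2 ≤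
      opBound q φ * ‖algAnnihilation q φ x‖ * ‖x‖ := by
    rw [← real_inner_self_eq_norm_sq, ← algCreation_adjoint]
    exact (real_inner_le_norm _ _).trans (mul_le_mul_of_nonneg_right h (norm_nonneg _))
  by_cases h0 : ‖algAnnihilation q φ x‖ = 0
  · rw [h0]; exact mul_nonneg (Real.sqrt_nonneg _) (norm_nonneg _)
  · have h2 : 0 < ‖algAnnihilation q φ x‖ := lt_of_le_of_ne (norm_nonneg _) (Ne.symm h0)
    nlinarith

theorem norm_algCreation_le (φ : H) (x : AlgFock q H) :
    ‖algCreation q φ x‖ ≤ opBound q φ * ‖x‖ := by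
  obtain ⟨N, hN⟩ := exists_degree (H := H) x
  have hC : 0 ≤ opBound q φ := Real.sqrt_nonneg _
  have step : ∀ x : AlgFock q H, ‖algAnnihilation q φ x‖ ≤ opBound q φ * ‖x‖ →
      ‖algCreation q φ x‖ ≤ opBound q φ * ‖x‖ := by
    intro x hx
    refine le_of_sq_le_sq ?_ (by positivity)
    rw [norm_sq_algCreation, mul_pow, ← opBound_sq q φ]
    have h1 : (q : ℝ) * ‖algAnnihilation q φ x‖ ^ 2 ≤
        |(q : ℝ)| * (opBound q φ * ‖x‖) ^ 2 :=
      mul_le_mul (le_abs_self _) (pow_le_pow_left₀ (norm_nonneg _) hx 2) (by positivity)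
        (abs_nonneg _)
    nlinarith
  induction N generalizing x with
  | zero =>
    refine step x ?_
    have : algAnnihilation q φ x = 0 := (annihilation_degree (q : ℝ) φ hN).1 rfl
    rw [this, norm_zero]
    positivity
  | succ N ih =>
    exact step x (norm_annihilation_le_of_creation q φ x
      (ih _ (annihilation_degree (q : ℝ) φ hN).2))

theorem norm_algAnnihilation_le (φ : H) (x : AlgFock q H) :
    ‖algAnnihilation q φ x‖ ≤ opBound q φ * ‖x‖ :=
  norm_annihilation_le_of_creation q φ x (norm_algCreation_le q φ _)

/-- The `q`-Fock space `ℱ_q(H)`: the completion of the finite algebraic vectors. Since `P_q^{(n)}` is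
bounded and bounded below by a positive constant for every `n`, this is the Hilbert direct sum of
the spaces `ℱ_q^{(n)}(H)`. -/
def Fock (q : Set.Ioo (-1 : ℝ) 1) (H : Type*) [NormedAddCommGroup H] [InnerProductSpace ℝ H] :
    Type _ :=
  UniformSpace.Completion (AlgFock q H)

instance : NormedAddCommGroup (Fock q H) :=
  inferInstanceAs (NormedAddCommGroup (UniformSpace.Completion (AlgFock q H)))

instance : InnerProductSpace ℝ (Fock q H) :=
  inferInstanceAs (InnerProductSpace ℝ (UniformSpace.Completion (AlgFock q H)))

instance : CompleteSpace (Fock q H) :=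
  inferInstanceAs (CompleteSpace (UniformSpace.Completion (AlgFock q H)))

/-- The embedding of the finite algebraic vectors. -/
def toFock : AlgFock q H →ₗᵢ[ℝ] Fock q H :=
  (UniformSpace.Completion.toComplₗᵢ : AlgFock q H →ₗᵢ[ℝ] UniformSpace.Completion (AlgFock q H))

/-- Continuous extension to the `q`-Fock space of an operator on finite algebraic vectors that is
bounded (see `extendOp_apply`). -/
def extendOp (T : AlgFock q H →ₗ[ℝ] AlgFock q H) : Fock q H →L[ℝ] Fock q H :=
  LinearMap.extendOfNorm ((toFock q).toLinearMap ∘ₗ T) (toFock q).toLinearMap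

theorem denseRange_toFock : DenseRange (toFock q : AlgFock q H → Fock q H) :=
  UniformSpace.Completion.denseRange_coe

theorem extendOp_apply (T : AlgFock q H →ₗ[ℝ] AlgFock q H) (C : ℝ) (hT : ∀ x, ‖T x‖ ≤ C * ‖x‖)
    (x : AlgFock q H) : extendOp q T (toFock q x) = toFock q (T x) :=
  LinearMap.extendOfNorm_eq (f := (toFock q).toLinearMap ∘ₗ T) (e := (toFock q).toLinearMap)
    (denseRange_toFock q)
    ⟨C, fun y => by simpa using hT y⟩ x

theorem op_ext {A B : Fock q H →L[ℝ] Fock q H}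
    (h : ∀ x, A (toFock q x) = B (toFock q x)) : A = B :=
  ContinuousLinearMap.coeFn_injective
    ((denseRange_toFock q).equalizer A.continuous B.continuous (funext h))

theorem extendOp_linear {T : H → AlgFock q H →ₗ[ℝ] AlgFock q H} {C : H → ℝ}
    (hT : ∀ φ x, ‖T φ x‖ ≤ C φ * ‖x‖)
    (h : ∀ (c : ℝ) φ ψ x, T (φ + c • ψ) x = T φ x + c • T ψ x) (c : ℝ) (φ ψ : H) :
    extendOp q (T (φ + c • ψ)) = extendOp q (T φ) + c • extendOp q (T ψ) :=
  op_ext q fun x => by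
    rw [add_apply, smul_apply, extendOp_apply q _ _ (hT _), extendOp_apply q _ _ (hT _),
      extendOp_apply q _ _ (hT _), h, map_add, map_smul]

/-- A linear map from a map that respects linear combinations. -/
def mkLinear {V : Type*} [AddCommGroup V] [Module ℝ V] (T : H → V)
    (h : ∀ (c : ℝ) φ ψ, T (φ + c • ψ) = T φ + c • T ψ) : H →ₗ[ℝ] V where
  toFun := T
  map_add' φ ψ := by simpa using h 1 φ ψ
  map_smul' c φ := by
    have h0 := h (-1) 0 0
    simp only [smul_zero, add_zero, neg_smul, one_smul, add_neg_cancel] at h0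
    simpa [h0] using h c 0 φ

theorem algCreation_add_smul (c : ℝ) (φ ψ : H) (x : AlgFock q H) :
    algCreation q (φ + c • ψ) x = algCreation q φ x + c • algCreation q ψ x := by
  let y : TensorAlgebra ℝ H := x
  change TensorAlgebra.ι ℝ (φ + c • ψ) * y = TensorAlgebra.ι ℝ φ * y + c • (TensorAlgebra.ι ℝ ψ * y)
  rw [map_add, map_smul, add_mul, smul_mul_assoc]

/-- The bounded creation operator `a⁺(φ)`, linear in `φ`. -/
def creation : H →ₗ[ℝ] Fock q H →L[ℝ] Fock q H :=
  mkLinear (fun φ => extendOp q (algCreation q φ))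
    (extendOp_linear q (norm_algCreation_le q) (algCreation_add_smul q))

theorem annihilationAlg_add_smul (r c : ℝ) (φ ψ : H) (x : TensorAlgebra ℝ H) :
    annihilationAlg r (φ + c • ψ) x = annihilationAlg r φ x + c • annihilationAlg r ψ x := by
  induction x using tensor_induction with
  | add x y hx hy => simp only [map_add, smul_add, hx, hy]; abel
  | smul s x hx => simp only [map_smul, hx, smul_add, smul_comm c s]
  | tprod n f =>
    cases n with
    | zero => simp only [annihilationAlg_tprod_zero, smul_zero, add_zero]
    | succ n =>
      simp only [annihilationAlg_tprod, Finset.smul_sum, ← Finset.sum_add_distrib, smul_smul,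
        ← add_smul]
      refine Finset.sum_congr rfl fun i _ => ?_
      congr 1
      rw [inner_add_left, real_inner_smul_left]
      ring

/-- The bounded annihilation operator `a⁻(φ)`, linear in `φ`. -/
def annihilation : H →ₗ[ℝ] Fock q H →L[ℝ] Fock q H :=
  mkLinear (fun φ => extendOp q (algAnnihilation q φ))
    (extendOp_linear q (norm_algAnnihilation_le q) (annihilationAlg_add_smul (q : ℝ)))

theorem creation_toFock (φ : H) (x : AlgFock q H) :
    creation q φ (toFock q x) = toFock q (algCreation q φ x) :=
  extendOp_apply q _ _ (norm_algCreation_le q φ) x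

theorem annihilation_toFock (φ : H) (x : AlgFock q H) :
    annihilation q φ (toFock q x) = toFock q (algAnnihilation q φ x) :=
  extendOp_apply q _ _ (norm_algAnnihilation_le q φ) x

/-- The normal ordered product `a⁺(f₁) ⋯ a⁺(fₙ) a⁻(g₁) ⋯ a⁻(g_m)` (empty products are the
identity). -/
def normalProd (f g : List H) : Fock q H →L[ℝ] Fock q H :=
  (f.map (creation q)).prod * (g.map (annihilation q)).prod

/-- The space `𝒲` spanned by the normal ordered products. -/
def NormalOrdered (H : Type*) [NormedAddCommGroup H] [InnerProductSpace ℝ H] :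
    Submodule ℝ (Fock q H →L[ℝ] Fock q H) :=
  Submodule.span ℝ {A | ∃ f g : List H, A = normalProd q f g}

/-- `w = g₁ ⊗ ⋯ ⊗ g_m` goes to `a⁻(g_m) ⋯ a⁻(g₁)` on the algebraic Fock space. -/
def antiAlg (r : ℝ) (H : Type*) [NormedAddCommGroup H] [InnerProductSpace ℝ H] :
    TensorAlgebra ℝ H →ₐ[ℝ] (Module.End ℝ (TensorAlgebra ℝ H))ᵐᵒᵖ :=
  TensorAlgebra.lift ℝ ((MulOpposite.opLinearEquiv ℝ).toLinearMap ∘ₗ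
    mkLinear (annihilationAlg r) fun c φ ψ => LinearMap.ext (annihilationAlg_add_smul r c φ ψ))

theorem antiAlg_ι_mul (r : ℝ) (g : H) (w h : TensorAlgebra ℝ H) :
    (antiAlg r H (TensorAlgebra.ι ℝ g * w)).unop h =
      (antiAlg r H w).unop (annihilationAlg r g h) := by
  rw [map_mul, MulOpposite.unop_mul, Module.End.mul_apply, antiAlg, TensorAlgebra.lift_ι_apply]
  rfl

theorem tprod_zero_eq_one (f : Fin 0 → H) : TensorAlgebra.tprod ℝ H 0 f = 1 := by
  simp [TensorAlgebra.tprod_apply]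

theorem tprod_succ (n : ℕ) (f : Fin (n + 1) → H) : TensorAlgebra.tprod ℝ H (n + 1) f =
    TensorAlgebra.ι ℝ (f 0) * TensorAlgebra.tprod ℝ H n (Fin.tail f) := by
  rw [ι_mul_tprod, Fin.cons_self_tail]

theorem antiAlg_tprod_degree (r : ℝ) (k : ℕ) (g : Fin k → H) :
    ∀ {N : ℕ} {h : TensorAlgebra ℝ H}, h ∈ degreeLE H N →
      (antiAlg r H (TensorAlgebra.tprod ℝ H k g)).unop h ∈ degreeLE H (N - k) := by
  induction k with
  | zero =>
    intro N h hh
    rw [tprod_zero_eq_one, map_one]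
    exact hh
  | succ k ih =>
    intro N h hh
    rw [tprod_succ, antiAlg_ι_mul, Nat.sub_succ', Nat.sub_right_comm]
    exact ih _ (annihilation_degree r _ hh).2

theorem fockForm_one_antiAlg (r : ℝ) (w h : TensorAlgebra ℝ H) :
    fockForm r H 1 ((antiAlg r H w).unop h) = fockForm r H w h := by
  induction w using tensor_induction with
  | add x y hx hy => simp only [map_add, MulOpposite.unop_add, LinearMap.add_apply, hx, hy]
  | smul c x hx => simp only [map_smul, MulOpposite.unop_smul, LinearMap.smul_apply, hx]
  | tprod n f =>
    induction n generalizing h with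
    | zero => rw [tprod_zero_eq_one, map_one (antiAlg r H)]; rfl
    | succ n ih => rw [tprod_succ, antiAlg_ι_mul, ih, fockForm_ι_mul]

theorem degree_zero (r : ℝ) {x : TensorAlgebra ℝ H} (hx : x ∈ degreeLE H 0) :
    x = fockForm r H 1 x • (1 : TensorAlgebra ℝ H) := by
  induction hx using Submodule.span_induction with
  | mem x hx =>
    obtain ⟨n, hn, f, rfl⟩ := hx
    obtain rfl : n = 0 := by omega
    have h : fockForm r H 1 1 = 1 := by
      rw [← tprod_zero_eq_one (H := H) Fin.elim0, fockForm_tprod]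
      simp [inversions]
    rw [tprod_zero_eq_one, h, one_smul]
  | zero => simp
  | add x y _ _ hx hy => rw [map_add, add_smul, ← hx, ← hy]
  | smul c x _ hx => rw [map_smul, smul_assoc, ← hx]

theorem toTensorAlgebra_mem (n : ℕ) (z : ⨂[ℝ]^n H) :
    TensorPower.toTensorAlgebra z ∈ degreeLE H n := by
  induction z using PiTensorProduct.induction_on with
  | smul_tprod c f =>
    rw [map_smul, TensorPower.toTensorAlgebra_tprod]
    exact Submodule.smul_mem _ _ (Submodule.subset_span ⟨n, le_rfl, f, rfl⟩)
  | add x y hx hy => rw [map_add]; exact add_mem hx hy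

theorem ofDirectSum_of {n : ℕ} (z : ⨂[ℝ]^n H) :
    TensorAlgebra.ofDirectSum (DirectSum.of (fun n => ⨂[ℝ]^n H) n z) =
      TensorPower.toTensorAlgebra z :=
  DirectSum.toAddMonoid_of (fun _ => LinearMap.toAddMonoidHom TensorPower.toTensorAlgebra) n z

theorem sum_components (w : TensorAlgebra ℝ H) : ∃ s : Finset ℕ,
    (∀ k, k ∉ s → TensorAlgebra.toDirectSum w k = 0) ∧
    w = ∑ k ∈ s, TensorPower.toTensorAlgebra (TensorAlgebra.toDirectSum w k) := by
  classical
  refine ⟨DFinsupp.support (TensorAlgebra.toDirectSum w),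
    fun n hn => DFinsupp.notMem_support_iff.1 hn, ?_⟩
  conv_lhs => rw [← TensorAlgebra.ofDirectSum_toDirectSum w,
    ← DirectSum.sum_support_of (TensorAlgebra.toDirectSum w)]
  rw [map_sum]
  exact Finset.sum_congr rfl fun k _ => ofDirectSum_of _

theorem antiAlg_degree (r : ℝ) {m : ℕ} {w h : TensorAlgebra ℝ H}
    (hw : ∀ k < m, TensorAlgebra.toDirectSum w k = 0) (hh : h ∈ degreeLE H m) :
    (antiAlg r H w).unop h ∈ degreeLE H 0 := by
  obtain ⟨s, -, hs⟩ := sum_components w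
  rw [hs, map_sum, Finset.unop_sum, LinearMap.sum_apply]
  refine Submodule.sum_mem _ fun k _ => ?_
  by_cases hk : k < m
  · rw [hw k hk]; simp
  · have : ∀ z : ⨂[ℝ]^k H,
        (antiAlg r H (TensorPower.toTensorAlgebra z)).unop h ∈ degreeLE H 0 := by
      intro z
      induction z using PiTensorProduct.induction_on with
      | smul_tprod c f =>
        rw [map_smul, map_smul, TensorPower.toTensorAlgebra_tprod, MulOpposite.unop_smul,
          LinearMap.smul_apply]
        have := antiAlg_tprod_degree r k f hh
        rw [Nat.sub_eq_zero_of_le (not_lt.1 hk)] at this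
        exact Submodule.smul_mem _ _ this
      | add x y hx hy =>
        rw [map_add, map_add, MulOpposite.unop_add, LinearMap.add_apply]
        exact add_mem hx hy
    exact this _

theorem toDirectSum_toTensorAlgebra {n : ℕ} (z : ⨂[ℝ]^n H) :
    TensorAlgebra.toDirectSum (TensorPower.toTensorAlgebra z) =
      DirectSum.of (fun n => ⨂[ℝ]^n H) n z := by
  rw [← TensorAlgebra.toDirectSum_ofDirectSum (DirectSum.of (fun n => ⨂[ℝ]^n H) n z)]
  rw [ofDirectSum_of]

theorem fockForm_component (r : ℝ) (m : ℕ) (w : TensorAlgebra ℝ H) :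
    fockForm r H w (TensorPower.toTensorAlgebra (TensorAlgebra.toDirectSum w m)) =
      qForm r H m (TensorAlgebra.toDirectSum w m) (TensorAlgebra.toDirectSum w m) := by
  rw [fockForm_symm, fockForm_apply r _ _ {m}, Finset.sum_singleton, toDirectSum_toTensorAlgebra,
    DirectSum.of_eq_same]
  intro n hn
  rw [toDirectSum_toTensorAlgebra, DirectSum.of_eq_of_ne]
  simpa using hn

/-- Normal ordered symbols act faithfully. -/
theorem symbol_faithful {ι : Type*} {b : ι → TensorAlgebra ℝ H} (hb : LinearIndependent ℝ b)
    (v : ι →₀ TensorAlgebra ℝ H)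
    (hv : ∀ h, (v.sum fun i w => b i * (antiAlg (q : ℝ) H w).unop h) = 0) : v = 0 := by
  have key : ∀ m i, TensorAlgebra.toDirectSum (v i) m = 0 := by
    intro m
    induction m using Nat.strong_induction_on with
    | _ m ih =>
      intro i
      refine (qForm_pos (abs_lt_one q) _).2 ?_
      rw [← fockForm_component]
      set h := TensorPower.toTensorAlgebra (TensorAlgebra.toDirectSum (v i) m) with hh
      have hd : h ∈ degreeLE H m := toTensorAlgebra_mem m _
      have h1 := hv h
      have h2 : ∀ j, b j * (antiAlg (q : ℝ) H (v j)).unop h = fockForm (q : ℝ) H (v j) h • b j := by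
        intro j
        rw [degree_zero (q : ℝ) (antiAlg_degree (q : ℝ) (fun k hk => ih k hk j) hd),
          fockForm_one_antiAlg, mul_smul_comm, mul_one]
      rw [Finsupp.sum, Finset.sum_congr rfl fun j _ => h2 j] at h1
      by_cases hi : i ∈ v.support
      · exact linearIndependent_iff'.1 hb _ _ h1 i hi
      · rw [Finsupp.notMem_support_iff.1 hi]; simp
  ext i
  obtain ⟨s, -, hs⟩ := sum_components (v i)
  rw [hs]
  simp [key]

/-- `u ⊗ w` goes to `a⁺(u) a⁻(w reversed)`. -/
def opSymbol (H : Type*) [NormedAddCommGroup H] [InnerProductSpace ℝ H] :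
    TensorAlgebra ℝ H ⊗[ℝ] TensorAlgebra ℝ H →ₗ[ℝ] Fock q H →L[ℝ] Fock q H :=
  TensorProduct.lift ((LinearMap.mul ℝ (Fock q H →L[ℝ] Fock q H)).compl₁₂
    (TensorAlgebra.lift ℝ (creation q)).toLinearMap
    ((MulOpposite.opLinearEquiv ℝ).symm.toLinearMap ∘ₗ
      (TensorAlgebra.lift ℝ
        ((MulOpposite.opLinearEquiv ℝ).toLinearMap ∘ₗ annihilation (H := H) q)).toLinearMap))

/-- The embedding of the tensor algebra, i.e. of the finite algebraic vectors, into `ℱ_q(H)`. -/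
def ofTensor : TensorAlgebra ℝ H →ₗ[ℝ] Fock q H :=
  LinearMap.comp (toFock q).toLinearMap (show TensorAlgebra ℝ H →ₗ[ℝ] AlgFock q H from LinearMap.id)

theorem ofTensor_injective : Function.Injective (ofTensor q (H := H)) := (toFock q).injective

theorem creation_ofTensor (φ : H) (x : TensorAlgebra ℝ H) :
    creation q φ (ofTensor q x) = ofTensor q (TensorAlgebra.ι ℝ φ * x) :=
  creation_toFock q φ x

theorem annihilation_ofTensor (φ : H) (x : TensorAlgebra ℝ H) :
    annihilation q φ (ofTensor q x) = ofTensor q (annihilationAlg (q : ℝ) φ x) :=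
  annihilation_toFock q φ x

theorem lift_creation_apply (u : TensorAlgebra ℝ H) (x : TensorAlgebra ℝ H) :
    TensorAlgebra.lift ℝ (creation q) u (ofTensor q x) = ofTensor q (u * x) := by
  induction u using TensorAlgebra.induction generalizing x with
  | algebraMap c =>
    rw [AlgHom.commutes, Algebra.algebraMap_eq_smul_one, Algebra.algebraMap_eq_smul_one,
      smul_mul_assoc, one_mul, map_smul]
    rfl
  | ι f => rw [TensorAlgebra.lift_ι_apply, creation_ofTensor]
  | mul a b ha hb => rw [map_mul, mul_apply_eq_comp, hb, ha, mul_assoc]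
  | add a b ha hb => rw [map_add, add_apply, ha, hb, add_mul, map_add]

theorem opSymbol_tmul (u w x : TensorAlgebra ℝ H) :
    opSymbol q H (u ⊗ₜ w) (ofTensor q x) = ofTensor q (u * (antiAlg (q : ℝ) H w).unop x) := by
  have h : ∀ x : TensorAlgebra ℝ H, (TensorAlgebra.lift ℝ
        ((MulOpposite.opLinearEquiv ℝ).toLinearMap ∘ₗ annihilation (H := H) q) w).unop
        (ofTensor q x) = ofTensor q ((antiAlg (q : ℝ) H w).unop x) := by
    induction w using TensorAlgebra.induction with
    | algebraMap c =>
      intro x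
      rw [AlgHom.commutes, AlgHom.commutes]
      exact ((ofTensor q).map_smul c _).symm
    | ι f =>
      intro x
      rw [antiAlg, TensorAlgebra.lift_ι_apply, TensorAlgebra.lift_ι_apply]
      exact annihilation_ofTensor q f x
    | mul a b ha hb =>
      intro x
      rw [map_mul, map_mul, MulOpposite.unop_mul, MulOpposite.unop_mul,
        mul_apply_eq_comp, ha, hb]
      rfl
    | add a b ha hb =>
      intro x
      rw [map_add, map_add, MulOpposite.unop_add, MulOpposite.unop_add, add_apply, ha, hb,
        LinearMap.add_apply, map_add]
  rw [opSymbol, TensorProduct.lift.tmul, LinearMap.compl₁₂_apply, ← lift_creation_apply, ← h]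
  rfl

theorem opSymbol_injective : Function.Injective (opSymbol q H) := by
  classical
  rw [injective_iff_map_eq_zero]
  intro z hz
  let B := Module.Basis.ofVectorSpace ℝ (TensorAlgebra ℝ H)
  let E := TensorProduct.equivFinsuppOfBasisLeft (N := TensorAlgebra ℝ H) B
  have hzE : z = (E z).sum fun i w => B i ⊗ₜ[ℝ] w := by
    rw [← TensorProduct.equivFinsuppOfBasisLeft_symm_apply, LinearEquiv.symm_apply_apply]
  have : E z = 0 := by
    refine symbol_faithful q B.linearIndependent _ fun h => ?_
    apply ofTensor_injective q
    have h0 : opSymbol q H z (ofTensor q h) = 0 := by rw [hz]; rfl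
    rw [hzE, Finsupp.sum, map_sum, sum_apply] at h0
    simp_rw [opSymbol_tmul] at h0
    rw [Finsupp.sum, map_sum, h0, map_zero]
  rw [hzE, this, Finsupp.sum_zero_index]

/-- The free vector space on pairs of words. -/
abbrev Words (H : Type*) : Type _ := (List H × List H) →₀ ℝ

/-- The tensor `f₁ ⊗ ⋯ ⊗ fₙ`. -/
def wordTensor : List H → TensorAlgebra ℝ H := fun f => (f.map (TensorAlgebra.ι ℝ)).prod

theorem wordTensor_append (f g : List H) : wordTensor (f ++ g) = wordTensor f * wordTensor g := by
  simp [wordTensor]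

theorem opSymbol_word (f g : List H) :
    opSymbol q H (wordTensor f ⊗ₜ wordTensor g.reverse) = normalProd q f g := by
  rw [opSymbol, TensorProduct.lift.tmul, LinearMap.compl₁₂_apply, wordTensor, wordTensor,
    normalProd]
  simp only [LinearMap.mul_apply', AlgHom.toLinearMap_apply, map_list_prod, List.map_map,
    LinearMap.comp_apply, LinearEquiv.coe_coe, MulOpposite.coe_opLinearEquiv_symm,
    MulOpposite.unop_list_prod, List.map_reverse, List.reverse_reverse]
  congr 2
  · refine List.map_congr_left fun x _ => ?_
    simp
  · refine List.map_congr_left fun x _ => ?_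
    simp

/-- The operator of a combination of words. -/
def wordOp (H : Type*) [NormedAddCommGroup H] [InnerProductSpace ℝ H] :
    Words H →ₗ[ℝ] NormalOrdered q H :=
  Finsupp.linearCombination ℝ fun p => ⟨normalProd q p.1 p.2, Submodule.subset_span ⟨_, _, rfl⟩⟩

/-- The Wick product on normal ordered expressions. -/
def wordWick (H : Type*) [NormedAddCommGroup H] [InnerProductSpace ℝ H] :
    Words H →ₗ[ℝ] Words H →ₗ[ℝ] NormalOrdered q H :=
  Finsupp.linearCombination ℝ fun p => Finsupp.linearCombination ℝ fun p' =>
    (q : ℝ) ^ (p'.1.length * p.2.length) •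
      ⟨normalProd q (p.1 ++ p'.1) (p.2 ++ p'.2), Submodule.subset_span ⟨_, _, rfl⟩⟩

theorem wordOp_surjective : Function.Surjective (wordOp q H) := by
  rintro ⟨A, hA⟩
  induction hA using Submodule.span_induction with
  | mem A hA =>
    obtain ⟨f, g, rfl⟩ := hA
    exact ⟨Finsupp.single (f, g) 1, by simp [wordOp]⟩
  | zero => exact ⟨0, map_zero _⟩
  | add A B _ _ hA hB =>
    obtain ⟨x, hx⟩ := hA
    obtain ⟨y, hy⟩ := hB
    exact ⟨x + y, by rw [map_add, hx, hy]; rfl⟩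
  | smul c A _ hA =>
    obtain ⟨x, hx⟩ := hA
    exact ⟨c • x, by rw [map_smul, hx]; rfl⟩

/-- The symbol of a combination of words. -/
def wordSymbol (H : Type*) [NormedAddCommGroup H] [InnerProductSpace ℝ H] :
    Words H →ₗ[ℝ] TensorAlgebra ℝ H ⊗[ℝ] TensorAlgebra ℝ H :=
  Finsupp.linearCombination ℝ fun p => wordTensor p.1 ⊗ₜ wordTensor p.2.reverse

theorem opSymbol_wordSymbol (x : Words H) :
    opSymbol q H (wordSymbol H x) = wordOp q H x := by
  have : opSymbol q H ∘ₗ wordSymbol H = (NormalOrdered q H).subtype ∘ₗ wordOp q H := by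
    ext1 p
    ext1
    simp [wordSymbol, wordOp, opSymbol_word]
  exact LinearMap.congr_fun this x

theorem wordSymbol_eq_zero {x : Words H} (hx : wordOp q H x = 0) : wordSymbol H x = 0 := by
  apply opSymbol_injective q
  rw [opSymbol_wordSymbol, hx, map_zero]
  rfl

/-- Multiplication of degree `n` by `t ^ n`. -/
def degreeScale (t : ℝ) : TensorAlgebra ℝ H →ₐ[ℝ] TensorAlgebra ℝ H :=
  TensorAlgebra.lift ℝ (t • TensorAlgebra.ι ℝ)

theorem degreeScale_word (t : ℝ) (f : List H) :
    degreeScale t (wordTensor f) = t ^ f.length • wordTensor f := by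
  induction f with
  | nil => simp [wordTensor]
  | cons a f ih =>
    have : wordTensor (a :: f) = TensorAlgebra.ι ℝ a * wordTensor f := by simp [wordTensor]
    rw [this, map_mul, ih, degreeScale, TensorAlgebra.lift_ι_apply, List.length_cons, pow_succ',
      LinearMap.smul_apply, smul_mul_smul_comm]

theorem wordWick_left {x : Words H} (hx : wordOp q H x = 0) (y : Words H) :
    wordWick q H x y = 0 := by
  have : ∀ p' : List H × List H, (NormalOrdered q H).subtype ∘ₗ
      (wordWick q H).flip (Finsupp.single p' 1) = opSymbol q H ∘ₗ
        TensorProduct.map (LinearMap.mulRight ℝ (wordTensor p'.1))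
          (LinearMap.mulLeft ℝ (wordTensor p'.2.reverse) ∘ₗ
            (degreeScale ((q : ℝ) ^ p'.1.length)).toLinearMap) ∘ₗ wordSymbol H := by
    intro p'
    ext1 p
    ext1
    simp [wordSymbol, wordWick, degreeScale_word, ← wordTensor_append, ← List.reverse_append,
      opSymbol_word, pow_mul]
  have h0 : wordWick q H x = 0 := by
    ext1 p'
    ext1
    apply Subtype.ext
    have := LinearMap.congr_fun (this p') x
    simp only [LinearMap.comp_apply, wordSymbol_eq_zero q hx, map_zero] at this
    exact this
  rw [h0]
  rfl

theorem wordWick_right {y : Words H} (hy : wordOp q H y = 0) (x : Words H) :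
    wordWick q H x y = 0 := by
  have : ∀ p : List H × List H, (NormalOrdered q H).subtype ∘ₗ
      wordWick q H (Finsupp.single p 1) = opSymbol q H ∘ₗ
        TensorProduct.map (LinearMap.mulLeft ℝ (wordTensor p.1) ∘ₗ
            (degreeScale ((q : ℝ) ^ p.2.length)).toLinearMap)
          (LinearMap.mulRight ℝ (wordTensor p.2.reverse)) ∘ₗ wordSymbol H := by
    intro p
    ext1 p'
    ext1
    simp [wordSymbol, wordWick, degreeScale_word, ← wordTensor_append, ← List.reverse_append,
      ← pow_mul, mul_comm]
    rw [← TensorProduct.smul_tmul', map_smul, opSymbol_word]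
  have h0 : (wordWick q H).flip y = 0 := by
    ext1 p
    ext1
    apply Subtype.ext
    have := LinearMap.congr_fun (this p) y
    simp only [LinearMap.comp_apply, wordSymbol_eq_zero q hy, map_zero] at this
    exact this
  exact LinearMap.congr_fun h0 x

/-- A linear choice of a normal ordered expression. -/
def wordSection (H : Type*) [NormedAddCommGroup H] [InnerProductSpace ℝ H] :
    NormalOrdered q H →ₗ[ℝ] Words H :=
  ((wordOp q H).exists_rightInverse_of_surjective
    (LinearMap.range_eq_top.2 (wordOp_surjective q))).choose

theorem wordOp_section (A : NormalOrdered q H) : wordOp q H (wordSection q H A) = A :=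
  LinearMap.congr_fun ((wordOp q H).exists_rightInverse_of_surjective
    (LinearMap.range_eq_top.2 (wordOp_surjective q))).choose_spec A

/-- The Wick product `⋄` on `𝒲`: write both factors as combinations of normal ordered products and
multiply these by the rule in `wickProduct_normalProd`. The result does not depend on the chosen
expressions (`wickProduct_wordOp`). -/
def wickProduct (H : Type*) [NormedAddCommGroup H] [InnerProductSpace ℝ H] :
    NormalOrdered q H →ₗ[ℝ] NormalOrdered q H →ₗ[ℝ] NormalOrdered q H :=
  (wordWick q H).compl₁₂ (wordSection q H) (wordSection q H)

theorem wickProduct_wordOp (x y : Words H) : wickProduct q H (wordOp q H x) (wordOp q H y) = wordWick q H x y := by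
  have hx : wordOp q H (wordSection q H (wordOp q H x) - x) = 0 := by
    rw [map_sub, wordOp_section, sub_self]
  have hy : wordOp q H (wordSection q H (wordOp q H y) - y) = 0 := by
    rw [map_sub, wordOp_section, sub_self]
  have h1 := wordWick_left q hx (wordSection q H (wordOp q H y))
  have h2 := wordWick_right q hy x
  rw [map_sub, LinearMap.sub_apply, sub_eq_zero] at h1
  rw [map_sub, sub_eq_zero] at h2
  rw [wickProduct, LinearMap.compl₁₂_apply, h1, h2]

/-- The rule that defines the Wick product. -/
theorem wickProduct_normalProd (f g φ ψ : List H) (h : normalProd q f g ∈ NormalOrdered q H)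
    (h' : normalProd q φ ψ ∈ NormalOrdered q H) :
    (wickProduct q H ⟨normalProd q f g, h⟩ ⟨normalProd q φ ψ, h'⟩ : Fock q H →L[ℝ] Fock q H) =
      (q : ℝ) ^ (φ.length * g.length) • normalProd q (f ++ φ) (g ++ ψ) := by
  have := wickProduct_wordOp q (Finsupp.single (f, g) 1) (Finsupp.single (φ, ψ) 1)
  simp only [wordOp, wordWick, Finsupp.linearCombination_single, one_smul] at this
  rw [this]
  rfl

/-- The vacuum vector `Ω`. -/
def vacuum (H : Type*) [NormedAddCommGroup H] [InnerProductSpace ℝ H] : Fock q H := ofTensor q 1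

/-- The smeared `q`-white noise `⟨ω, φ⟩ = a⁺(φ) + a⁻(φ)`. -/
def whiteNoise : H →ₗ[ℝ] Fock q H →L[ℝ] Fock q H := creation q + annihilation q

/-- The algebra `𝒫` of noncommutative polynomials: the real algebra generated by the operators
`⟨ω, φ⟩`. -/
def NoisePoly (H : Type*) [NormedAddCommGroup H] [InnerProductSpace ℝ H] :
    Subalgebra ℝ (Fock q H →L[ℝ] Fock q H) :=
  Algebra.adjoin ℝ (Set.range (whiteNoise q (H := H)))

/-- The monomial `⟨ω^{⊗n}, f⟩`, the linear extension of `⟨ω, f₁⟩ ⋯ ⟨ω, fₙ⟩`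
(see `noiseMonomial_tprod`). -/
def noiseMonomial (n : ℕ) : ⨂[ℝ]^n H →ₗ[ℝ] NoisePoly q H :=
  PiTensorProduct.lift ((MultilinearMap.mkPiAlgebraFin ℝ n (NoisePoly q H)).compLinearMap fun _ =>
    (whiteNoise q).codRestrict (Subalgebra.toSubmodule (NoisePoly q H))
      fun φ => Algebra.subset_adjoin ⟨φ, rfl⟩)

theorem noiseMonomial_tprod {n : ℕ} (f : Fin n → H) :
    (noiseMonomial q n (PiTensorProduct.tprod ℝ f) : Fock q H →L[ℝ] Fock q H) =
      (List.ofFn fun i => whiteNoise q (f i)).prod := by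
  rw [noiseMonomial, PiTensorProduct.lift.tprod, MultilinearMap.compLinearMap_apply,
    MultilinearMap.mkPiAlgebraFin_apply, ← Subalgebra.coe_val, map_list_prod, List.map_ofFn]
  rfl

/-- The vacuum expectation `μ(A) = (A Ω, Ω)`. -/
def vacuumExp (A : Fock q H →L[ℝ] Fock q H) : ℝ := ⟪A (vacuum q H), vacuum q H⟫_ℝ

/-- A copy of `𝒫`, to carry the scalar product of `L²(μ)` instead of the operator norm. -/
def PreNoisePoly (H : Type*) [NormedAddCommGroup H] [InnerProductSpace ℝ H] : Type _ := NoisePoly q H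

instance : AddCommGroup (PreNoisePoly q H) := inferInstanceAs (AddCommGroup (NoisePoly q H))

instance : Module ℝ (PreNoisePoly q H) := inferInstanceAs (Module ℝ (NoisePoly q H))

/-- The identity of `𝒫`. -/
def prePolyEquiv (H : Type*) [NormedAddCommGroup H] [InnerProductSpace ℝ H] :
    NoisePoly q H ≃ₗ[ℝ] PreNoisePoly q H :=
  LinearEquiv.refl ℝ (NoisePoly q H)

/-- The operator underlying an element of `PreNoisePoly q H`. -/
def prePolyOp (H : Type*) [NormedAddCommGroup H] [InnerProductSpace ℝ H] :
    PreNoisePoly q H →ₗ[ℝ] Fock q H →L[ℝ] Fock q H :=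
  (NoisePoly q H).val.toLinearMap ∘ₗ (prePolyEquiv q H).symm.toLinearMap

theorem vacuumExp_adjoint_mul (A B : Fock q H →L[ℝ] Fock q H) :
    vacuumExp q (ContinuousLinearMap.adjoint B * A) =
      ⟪A (vacuum q H), B (vacuum q H)⟫_ℝ := by
  rw [vacuumExp, mul_apply_eq_comp, ContinuousLinearMap.adjoint_inner_left]

/-- The scalar product `(P₁, P₂) = μ(P₂* P₁)`. -/
@[reducible]
def polyCore (H : Type*) [NormedAddCommGroup H] [InnerProductSpace ℝ H] :
    PreInnerProductSpace.Core ℝ (PreNoisePoly q H) where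
  inner P₁ P₂ := vacuumExp q (ContinuousLinearMap.adjoint (prePolyOp q H P₂) * prePolyOp q H P₁)
  conj_inner_symm x y := by
    simp only [vacuumExp_adjoint_mul, conj_trivial]
    exact real_inner_comm (prePolyOp q H x (vacuum q H)) (prePolyOp q H y (vacuum q H))
  re_inner_nonneg x := by
    rw [vacuumExp_adjoint_mul]
    exact real_inner_self_nonneg (x := prePolyOp q H x (vacuum q H))
  add_left x y z := by
    simp only [vacuumExp_adjoint_mul, map_add, add_apply, inner_add_left]
  smul_left x y r := by
    simp only [vacuumExp_adjoint_mul, map_smul, smul_apply, inner_smul_left]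

instance : SeminormedAddCommGroup (PreNoisePoly q H) :=
  @InnerProductSpace.Core.toSeminormedAddCommGroup ℝ (PreNoisePoly q H) _ _ _ (polyCore q H)

instance : InnerProductSpace ℝ (PreNoisePoly q H) := InnerProductSpace.ofCore (polyCore q H)

/-- The noncommutative space `L²(μ)`: the completion of `𝒫` for the scalar product `μ(P₂* P₁)`. -/
def VacuumL2 (H : Type*) [NormedAddCommGroup H] [InnerProductSpace ℝ H] : Type _ :=
  UniformSpace.Completion (PreNoisePoly q H)

instance : NormedAddCommGroup (VacuumL2 q H) :=
  inferInstanceAs (NormedAddCommGroup (UniformSpace.Completion (PreNoisePoly q H)))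

instance : InnerProductSpace ℝ (VacuumL2 q H) :=
  inferInstanceAs (InnerProductSpace ℝ (UniformSpace.Completion (PreNoisePoly q H)))

instance : CompleteSpace (VacuumL2 q H) :=
  inferInstanceAs (CompleteSpace (UniformSpace.Completion (PreNoisePoly q H)))

/-- The embedding of `𝒫` into its completion. -/
def prePolyToL2 : PreNoisePoly q H →ₗᵢ[ℝ] VacuumL2 q H :=
  (UniformSpace.Completion.toComplₗᵢ : PreNoisePoly q H →ₗᵢ[ℝ] UniformSpace.Completion (PreNoisePoly q H))

/-- The canonical map `𝒫 → L²(μ)`. -/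
def toL2 (H : Type*) [NormedAddCommGroup H] [InnerProductSpace ℝ H] : NoisePoly q H →ₗ[ℝ] VacuumL2 q H :=
  (prePolyToL2 q).toLinearMap ∘ₗ (prePolyEquiv q H).toLinearMap

theorem inner_toL2 (P₁ P₂ : NoisePoly q H) : ⟪toL2 q H P₁, toL2 q H P₂⟫_ℝ =
    vacuumExp q (ContinuousLinearMap.adjoint (P₂ : Fock q H →L[ℝ] Fock q H) *
      (P₁ : Fock q H →L[ℝ] Fock q H)) :=
  (prePolyToL2 q).inner_map_map (prePolyEquiv q H P₁) (prePolyEquiv q H P₂)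

theorem denseRange_prePolyToL2 : DenseRange (prePolyToL2 q (H := H)) :=
  UniformSpace.Completion.denseRange_coe (α := PreNoisePoly q H)

theorem denseRange_toL2 : DenseRange (toL2 q H) :=
  (denseRange_prePolyToL2 q).comp (prePolyEquiv q H).surjective.denseRange
    (prePolyToL2 q (H := H)).continuous

/-- The map `P ↦ P Ω`. -/
def applyVacuum (H : Type*) [NormedAddCommGroup H] [InnerProductSpace ℝ H] :
    NoisePoly q H →ₗ[ℝ] Fock q H where
  toFun P := (P : Fock q H →L[ℝ] Fock q H) (vacuum q H)
  map_add' _ _ := rfl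
  map_smul' _ _ := rfl

theorem norm_applyVacuum (P : NoisePoly q H) : ‖applyVacuum q H P‖ = ‖toL2 q H P‖ := by
  rw [← sq_eq_sq₀ (norm_nonneg _) (norm_nonneg _), ← real_inner_self_eq_norm_sq,
    ← real_inner_self_eq_norm_sq, inner_toL2, vacuumExp_adjoint_mul]
  rfl

/-- The continuous extension of `P ↦ P Ω` to `L²(μ)`. -/
def vacuumCLM (H : Type*) [NormedAddCommGroup H] [InnerProductSpace ℝ H] :
    VacuumL2 q H →L[ℝ] Fock q H :=
  (applyVacuum q H).extendOfNorm (toL2 q H)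

theorem vacuumCLM_toL2 (P : NoisePoly q H) : vacuumCLM q H (toL2 q H P) = applyVacuum q H P :=
  LinearMap.extendOfNorm_eq (denseRange_toL2 q)
    ⟨1, fun P => by rw [norm_applyVacuum, one_mul]⟩ P

/-- The map `I : L²(μ) → ℱ_q(H)`, the continuous extension of `P ↦ P Ω`, as a linear isometry. -/
def vacuumUnitary (H : Type*) [NormedAddCommGroup H] [InnerProductSpace ℝ H] :
    VacuumL2 q H →ₗᵢ[ℝ] Fock q H where
  toLinearMap := (vacuumCLM q H).toLinearMap
  norm_map' x := by
    refine (denseRange_toL2 q).induction_on x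
      (isClosed_eq (vacuumCLM q H).continuous.norm continuous_norm) fun P => ?_
    rw [← norm_applyVacuum, ← vacuumCLM_toL2]
    rfl

theorem vacuumUnitary_toL2 (P : NoisePoly q H) :
    vacuumUnitary q H (toL2 q H P) = (P : Fock q H →L[ℝ] Fock q H) (vacuum q H) :=
  vacuumCLM_toL2 q P

/-- The space of finite vectors `(f⁽⁰⁾, f⁽¹⁾, …, f⁽ⁿ⁾, 0, 0, …)` with algebraic tensors `f⁽ⁱ⁾`, as a
subspace of `ℱ_q(H)`. Its tensor multiplication is the multiplication of the tensor algebra,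
carried over by the injective map `ofTensor`. -/
def finiteVectors (H : Type*) [NormedAddCommGroup H] [InnerProductSpace ℝ H] :
    Submodule ℝ (Fock q H) :=
  LinearMap.range (ofTensor q)

/-- The space `𝒫_k` of polynomials of order at most `k`. -/
def polyLE (H : Type*) [NormedAddCommGroup H] [InnerProductSpace ℝ H] (k : ℕ) :
    Submodule ℝ (NoisePoly q H) :=
  ⨆ n ≤ k, LinearMap.range (noiseMonomial q n)

/-- The closure `ℳ𝒫_k` of `𝒫_k` in `L²(μ)`. -/
def measurablePoly (H : Type*) [NormedAddCommGroup H] [InnerProductSpace ℝ H] (k : ℕ) :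
    Submodule ℝ (VacuumL2 q H) :=
  ((polyLE q H k).map (toL2 q H)).topologicalClosure

/-- The orthogonal difference `𝒪𝒫_k = ℳ𝒫_k ⊖ ℳ𝒫_{k-1}`, with `𝒪𝒫_0 = ℳ𝒫_0`. -/
def orthogonalPoly (H : Type*) [NormedAddCommGroup H] [InnerProductSpace ℝ H] : ℕ → Submodule ℝ (VacuumL2 q H)
  | 0 => measurablePoly q H 0
  | k + 1 => measurablePoly q H (k + 1) ⊓ (measurablePoly q H k)ᗮ

instance (n : ℕ) : CompleteSpace (orthogonalPoly q H n) := by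
  refine IsClosed.completeSpace_coe (hs := ?_)
  cases n with
  | zero => exact Submodule.isClosed_topologicalClosure _
  | succ k =>
    exact (Submodule.isClosed_topologicalClosure _).inter (Submodule.isClosed_orthogonal _)

/-- `⟨:ω^{⊗n}:, f⟩`, the orthogonal projection of the monomial `⟨ω^{⊗n}, f⟩` onto `𝒪𝒫_n`. -/
def wickMonomial (n : ℕ) (f : ⨂[ℝ]^n H) : VacuumL2 q H :=
  (orthogonalPoly q H n).starProjection (toL2 q H (noiseMonomial q n f))

end QWhiteNoise

end

open QWhiteNoise

noncomputable section

namespace QWhiteNoise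

variable {H : Type*} [NormedAddCommGroup H] [InnerProductSpace ℝ H]

/-! ### Words and degrees in the tensor algebra -/

/-! Everything rests on an explicit inverse `W` of the map `P ↦ P Ω`, defined on the tensor algebra
(`wickOp`, as an isomorphism onto `𝒫`: `wickEquiv`). It is built on normal ordered symbols by `W(1)
= 1` and `W(f ⊗ u) = ⟨ω, f⟩ ⋄ W(u)`.

The key is to compare the operator product with the Wick product. Moving `a⁻(f)` to the right of
`a⁺(u)` gives `q^{deg u} a⁺(u) a⁻(f)`, which is the Wick rule, plus a contraction of `f` with `u`
(`annihilationAlg_mul`, `whiteNoise_mul_opSymbol`). Contracting `W(u)` with `f` yields `W(a⁻(f) u)`,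
because contraction and Wick multiplication satisfy the same `q`-commutation relation as
annihilation and creation (`contractSymbol_wickSymbol`). Hence `⟨ω, f⟩ W(u) = W(f ⊗ u + a⁻(f) u)`
(`whiteNoise_mul_wickOp`). By induction on the degree this recursion gives `W(u) Ω = u` and `W(u) ∈
𝒫`. It also shows that the range of `W` is stable under left multiplication by `𝒫`; as it contains
`1`, it is all of `𝒫`. So `W` is bijective and `I ∘ W` is the embedding of the finite vectors. Since
`W(u)` is given in normal ordered form, `𝒫 ⊆ 𝒲`.

Multiplicativity `W(u) ⋄ W(v) = W(u ⊗ v)` follows from `(⟨ω, f⟩ ⋄ x) ⋄ y = ⟨ω, f⟩ ⋄ (x ⋄ y)`,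
checked on words (`wordMul_wordNoise`), so `⋄` on `𝒫` is the tensor product transported by `W`.
Finally the recursion shows that a monomial of order `n` is `W` of its tensor plus `W` of lower
degrees. As `W` is isometric and different degrees are orthogonal, the projection onto `𝒪𝒫_n` keeps
exactly the first part (`wickMonomial_eq`). -/

theorem wordTensor_nil : wordTensor ([] : List H) = 1 := rfl

theorem wordTensor_cons (f : H) (l : List H) :
    wordTensor (f :: l) = TensorAlgebra.ι ℝ f * wordTensor l := by
  simp [wordTensor]

theorem wordTensor_ofFn {n : ℕ} (f : Fin n → H) :
    wordTensor (List.ofFn f) = TensorAlgebra.tprod ℝ H n f := by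
  rw [wordTensor, List.map_ofFn, TensorAlgebra.tprod_apply]
  rfl

theorem wordTensor_eq_tprod (l : List H) :
    wordTensor l = TensorAlgebra.tprod ℝ H l.length l.get := by
  rw [← wordTensor_ofFn, List.ofFn_get]

/-- Lists replace families over `Fin n` so that the recursion `f :: l` is available and the match
with `Words` is direct. -/
theorem word_induction {p : TensorAlgebra ℝ H → Prop} (word : ∀ l, p (wordTensor l))
    (add : ∀ x y, p x → p y → p (x + y)) (smul : ∀ (r : ℝ) x, p x → p (r • x))
    (x : TensorAlgebra ℝ H) : p x :=
  tensor_induction (fun _ f => wordTensor_ofFn f ▸ word (List.ofFn f)) add smul x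

theorem hom_ext_words {V : Type*} [AddCommGroup V] [Module ℝ V] {A B : TensorAlgebra ℝ H →ₗ[ℝ] V}
    (h : ∀ l, A (wordTensor l) = B (wordTensor l)) : A = B :=
  LinearMap.ext fun x => word_induction (p := fun x => A x = B x) h
    (fun x y hx hy => by rw [map_add, map_add, hx, hy])
    (fun r x hx => by rw [map_smul, map_smul, hx]) x

/-- Tensors of degree less than `N`. -/
def degreeLT (H : Type*) [NormedAddCommGroup H] [InnerProductSpace ℝ H] (N : ℕ) :
    Submodule ℝ (TensorAlgebra ℝ H) :=
  Submodule.span ℝ (wordTensor '' {l | l.length < N})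

theorem wordTensor_mem_degreeLT {N : ℕ} {l : List H} (h : l.length < N) :
    wordTensor l ∈ degreeLT H N :=
  Submodule.subset_span ⟨l, h, rfl⟩

theorem degreeLT_mono {N M : ℕ} (h : N ≤ M) : degreeLT H N ≤ degreeLT H M :=
  Submodule.span_mono (Set.image_mono fun _ hl => lt_of_lt_of_le hl h)

theorem degreeLT_le {N : ℕ} {S : Submodule ℝ (TensorAlgebra ℝ H)}
    (h : ∀ l : List H, l.length < N → wordTensor l ∈ S) : degreeLT H N ≤ S :=
  Submodule.span_le.2 (by rintro _ ⟨l, hl, rfl⟩; exact h l hl)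

theorem ι_mul_mem_degreeLT (f : H) {N : ℕ} {x : TensorAlgebra ℝ H} (hx : x ∈ degreeLT H N) :
    TensorAlgebra.ι ℝ f * x ∈ degreeLT H (N + 1) := by
  have : degreeLT H N ≤ (degreeLT H (N + 1)).comap (LinearMap.mulLeft ℝ (TensorAlgebra.ι ℝ f)) :=
    degreeLT_le fun l hl => by
      rw [Submodule.mem_comap, LinearMap.mulLeft_apply, ← wordTensor_cons]
      exact wordTensor_mem_degreeLT (by simpa using hl)
  exact this hx

theorem annihilationAlg_one (r : ℝ) (g : H) : annihilationAlg r g 1 = 0 := by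
  rw [← tprod_zero_eq_one (H := H) Fin.elim0, annihilationAlg_tprod_zero]

/-- Annihilation strictly lowers the degree, and kills degree zero. This makes the recursion for
Wick polynomials well-founded. -/
theorem annihilationAlg_word_mem (r : ℝ) (g : H) (l : List H) :
    annihilationAlg r g (wordTensor l) ∈ degreeLT H l.length := by
  induction l with
  | nil => rw [wordTensor_nil, annihilationAlg_one]; exact zero_mem _
  | cons f l ih =>
    rw [wordTensor_cons, annihilationAlg_ι_mul, List.length_cons]
    exact add_mem (Submodule.smul_mem _ _ (wordTensor_mem_degreeLT (Nat.lt_succ_self _)))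
      (Submodule.smul_mem _ _ (ι_mul_mem_degreeLT f ih))

/-- The loss of one degree is given away here; staying below `N` is all that the inductions on
degree need. -/
theorem annihilationAlg_mem_degreeLT (r : ℝ) (g : H) {N : ℕ} {x : TensorAlgebra ℝ H}
    (hx : x ∈ degreeLT H N) : annihilationAlg r g x ∈ degreeLT H N := by
  have : degreeLT H N ≤ (degreeLT H N).comap (annihilationAlg r g) :=
    degreeLT_le fun l hl => degreeLT_mono hl.le (annihilationAlg_word_mem r g l)
  exact this hx

/-- Tensors of different degrees are orthogonal. -/
theorem fockForm_toTensorAlgebra_degreeLT (r : ℝ) {n : ℕ} (z : ⨂[ℝ]^n H) {x : TensorAlgebra ℝ H}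
    (hx : x ∈ degreeLT H n) : fockForm r H (TensorPower.toTensorAlgebra z) x = 0 := by
  induction z using PiTensorProduct.induction_on with
  | smul_tprod c f =>
    rw [map_smul, map_smul, TensorPower.toTensorAlgebra_tprod, LinearMap.smul_apply]
    have : degreeLT H n ≤ LinearMap.ker (fockForm r H (TensorAlgebra.tprod ℝ H n f)) :=
      degreeLT_le fun l hl => by
        rw [LinearMap.mem_ker, wordTensor_eq_tprod, fockForm_tprod_ne r hl.ne']
    rw [LinearMap.mem_ker.1 (this hx), smul_zero]
  | add a b ha hb => rw [map_add, map_add, LinearMap.add_apply, ha, hb, add_zero]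

/-! ### Wick multiplication by a noise variable, on symbols -/

theorem degreeScale_ι (t : ℝ) (f : H) :
    degreeScale t (TensorAlgebra.ι ℝ f) = t • TensorAlgebra.ι ℝ f := by
  rw [degreeScale, TensorAlgebra.lift_ι_apply, LinearMap.smul_apply]

/-- The annihilation operator is a `q`-twisted derivation. -/
theorem annihilationAlg_mul (r : ℝ) (g : H) (u x : TensorAlgebra ℝ H) :
    annihilationAlg r g (u * x) =
      annihilationAlg r g u * x + degreeScale r u * annihilationAlg r g x := by
  induction u using word_induction with
  | word l =>
    induction l with
    | nil => simp [wordTensor_nil, annihilationAlg_one]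
    | cons f l ih =>
      rw [wordTensor_cons, mul_assoc, annihilationAlg_ι_mul, ih, annihilationAlg_ι_mul, map_mul,
        degreeScale_ι]
      simp only [mul_add, add_mul, smul_add, smul_mul_assoc, mul_assoc, add_assoc]
  | add a b ha hb => simp only [add_mul, map_add, ha, hb]; abel
  | smul c a ha => simp only [smul_mul_assoc, map_smul, ha, smul_add]

/-- Annihilation removes one factor, so scaling beforehand counts one power of `r` more than scaling
afterwards. -/
theorem annihilationAlg_degreeScale (r : ℝ) (g : H) (u : TensorAlgebra ℝ H) :
    annihilationAlg r g (degreeScale r u) = r • degreeScale r (annihilationAlg r g u) := by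
  induction u using word_induction with
  | word l =>
    induction l with
    | nil => simp [wordTensor_nil, annihilationAlg_one]
    | cons f l ih =>
      rw [wordTensor_cons, map_mul, degreeScale_ι, smul_mul_assoc, map_smul,
        annihilationAlg_ι_mul, ih, annihilationAlg_ι_mul, map_add, map_smul, map_smul, map_mul,
        degreeScale_ι]
      simp only [smul_add, mul_smul_comm, smul_mul_assoc]
  | add a b ha hb => simp only [map_add, ha, hb, smul_add]
  | smul c a ha => simp only [map_smul, ha, smul_comm c]

/-- The symbol of `⟨ω, f⟩ ⋄ A`, as a function of the symbol of `A`. -/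
def wickLeft (r : ℝ) (H : Type*) [NormedAddCommGroup H] [InnerProductSpace ℝ H] :
    H →ₗ[ℝ] Module.End ℝ (TensorAlgebra ℝ H ⊗[ℝ] TensorAlgebra ℝ H) :=
  (TensorProduct.mapBilinear (RingHom.id ℝ) _ _ _ _).flip LinearMap.id ∘ₗ
      LinearMap.mul ℝ (TensorAlgebra ℝ H) ∘ₗ TensorAlgebra.ι ℝ +
    TensorProduct.mapBilinear (RingHom.id ℝ) _ _ _ _ (degreeScale r).toLinearMap ∘ₗ
      (LinearMap.mul ℝ (TensorAlgebra ℝ H)).flip ∘ₗ TensorAlgebra.ι ℝ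

/-- The second slot lists annihilators in reverse order, so appending `f` on the right of `w` makes
`a⁻(f)` the leftmost annihilator. The factor `r ^ deg u` of the Wick rule, for passing the creators
in `u`, is supplied by `degreeScale`. -/
theorem wickLeft_tmul (r : ℝ) (f : H) (u w : TensorAlgebra ℝ H) :
    wickLeft r H f (u ⊗ₜ w) = (TensorAlgebra.ι ℝ f * u) ⊗ₜ w +
      degreeScale r u ⊗ₜ (w * TensorAlgebra.ι ℝ f) := by
  simp [wickLeft]

/-- Contraction of `g` with the creation part of a symbol. -/
def contractSymbol (r : ℝ) (g : H) :
    Module.End ℝ (TensorAlgebra ℝ H ⊗[ℝ] TensorAlgebra ℝ H) :=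
  (annihilationAlg r g).rTensor _

theorem contractSymbol_tmul (r : ℝ) (g : H) (u w : TensorAlgebra ℝ H) :
    contractSymbol r g (u ⊗ₜ w) = annihilationAlg r g u ⊗ₜ w := rfl

/-- This is the `q`-commutation relation of `annihilationAlg_ι_mul`, with Wick multiplication in the
role of creation. The creation term of `wickLeft` inherits it directly; in the annihilation term the
factor `r` comes from `annihilationAlg_degreeScale`. -/
theorem contractSymbol_wickLeft (r : ℝ) (f g : H) (z : TensorAlgebra ℝ H ⊗[ℝ] TensorAlgebra ℝ H) :
    contractSymbol r g (wickLeft r H f z) =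
      ⟪g, f⟫_ℝ • z + r • wickLeft r H f (contractSymbol r g z) := by
  induction z with
  | zero => simp
  | add a b ha hb => simp only [map_add, ha, hb, smul_add]; abel
  | tmul u w =>
    rw [wickLeft_tmul, map_add, contractSymbol_tmul, contractSymbol_tmul, contractSymbol_tmul,
      wickLeft_tmul, annihilationAlg_ι_mul, annihilationAlg_degreeScale, TensorProduct.add_tmul,
      smul_add]
    simp only [TensorProduct.smul_tmul', add_assoc]

/-- The symbol of the Wick polynomial `:⟨ω^{⊗n}, u⟩:`. -/
def wickSymbol (r : ℝ) (H : Type*) [NormedAddCommGroup H] [InnerProductSpace ℝ H] :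
    TensorAlgebra ℝ H →ₗ[ℝ] TensorAlgebra ℝ H ⊗[ℝ] TensorAlgebra ℝ H :=
  LinearMap.applyₗ (1 ⊗ₜ[ℝ] 1) ∘ₗ (TensorAlgebra.lift ℝ (wickLeft r H)).toLinearMap

theorem wickSymbol_one (r : ℝ) : wickSymbol r H 1 = 1 ⊗ₜ[ℝ] 1 := by
  simp [wickSymbol]

theorem wickSymbol_ι_mul (r : ℝ) (f : H) (u : TensorAlgebra ℝ H) :
    wickSymbol r H (TensorAlgebra.ι ℝ f * u) = wickLeft r H f (wickSymbol r H u) := by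
  simp [wickSymbol]

/-- Both sides obey the same `q`-commutation relation with left multiplication by `f` and vanish at
`u = 1`, so they agree on every word. Thus contractions of a Wick polynomial are again Wick
polynomials. -/
theorem contractSymbol_wickSymbol (r : ℝ) (g : H) (u : TensorAlgebra ℝ H) :
    contractSymbol r g (wickSymbol r H u) = wickSymbol r H (annihilationAlg r g u) := by
  induction u using word_induction with
  | word l =>
    induction l with
    | nil =>
      rw [wordTensor_nil, annihilationAlg_one, wickSymbol_one, contractSymbol_tmul,
        annihilationAlg_one, map_zero, TensorProduct.zero_tmul]
    | cons f l ih =>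
      rw [wordTensor_cons, wickSymbol_ι_mul, contractSymbol_wickLeft, ih, annihilationAlg_ι_mul,
        map_add, map_smul, map_smul, wickSymbol_ι_mul]
  | add a b ha hb => simp only [map_add, ha, hb]
  | smul c a ha => simp only [map_smul, ha]

/-! ### Wick polynomials as operators -/

variable (q : Set.Ioo (-1 : ℝ) 1)

theorem op_ext_ofTensor {A B : Fock q H →L[ℝ] Fock q H}
    (h : ∀ x : TensorAlgebra ℝ H, A (ofTensor q x) = B (ofTensor q x)) : A = B :=
  op_ext q h

theorem whiteNoise_ofTensor (f : H) (x : TensorAlgebra ℝ H) : whiteNoise q f (ofTensor q x) =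
    ofTensor q (TensorAlgebra.ι ℝ f * x + annihilationAlg (q : ℝ) f x) := by
  rw [whiteNoise, LinearMap.add_apply, add_apply, creation_ofTensor, annihilation_ofTensor, map_add]

theorem antiAlg_mul_ι (r : ℝ) (f : H) (w x : TensorAlgebra ℝ H) :
    (antiAlg r H (w * TensorAlgebra.ι ℝ f)).unop x =
      annihilationAlg r f ((antiAlg r H w).unop x) := by
  rw [map_mul, MulOpposite.unop_mul, Module.End.mul_apply, antiAlg, TensorAlgebra.lift_ι_apply]
  rfl

/-- The operator product is the Wick product plus one contraction: in `a⁻(f) a⁺(u)` the twisted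
Leibniz rule `annihilationAlg_mul` separates the contraction with `u` from the reordered term. -/
theorem whiteNoise_mul_opSymbol (f : H) (z : TensorAlgebra ℝ H ⊗[ℝ] TensorAlgebra ℝ H) :
    whiteNoise q f * opSymbol q H z =
      opSymbol q H (wickLeft (q : ℝ) H f z) + opSymbol q H (contractSymbol (q : ℝ) f z) := by
  induction z with
  | zero => simp
  | add a b ha hb => simp only [map_add, mul_add, ha, hb]; abel
  | tmul u w =>
    refine op_ext_ofTensor q fun x => ?_
    rw [mul_apply_eq_comp, add_apply, wickLeft_tmul, map_add, add_apply, contractSymbol_tmul,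
      opSymbol_tmul, opSymbol_tmul, opSymbol_tmul, opSymbol_tmul, whiteNoise_ofTensor,
      antiAlg_mul_ι, annihilationAlg_mul, map_add, map_add, mul_assoc]
    abel

/-- The Wick polynomial `:⟨ω^{⊗n}, u⟩:` in normal ordered form. -/
def wickOp (H : Type*) [NormedAddCommGroup H] [InnerProductSpace ℝ H] :
    TensorAlgebra ℝ H →ₗ[ℝ] Fock q H →L[ℝ] Fock q H :=
  opSymbol q H ∘ₗ wickSymbol (q : ℝ) H

theorem wickOp_one : wickOp q H 1 = 1 := by
  rw [wickOp, LinearMap.comp_apply, wickSymbol_one]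
  refine op_ext_ofTensor q fun x => ?_
  rw [opSymbol_tmul, map_one]
  simp

/-- Left multiplication by noise acts on Wick polynomials as creation plus annihilation acts on
tensors. This recursion drives all that follows about `𝒫`. -/
theorem whiteNoise_mul_wickOp (f : H) (u : TensorAlgebra ℝ H) : whiteNoise q f * wickOp q H u =
    wickOp q H (TensorAlgebra.ι ℝ f * u + annihilationAlg (q : ℝ) f u) := by
  rw [wickOp, LinearMap.comp_apply, whiteNoise_mul_opSymbol, contractSymbol_wickSymbol, map_add,
    LinearMap.comp_apply, LinearMap.comp_apply, wickSymbol_ι_mul]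

theorem wickOp_ι_mul (f : H) (u : TensorAlgebra ℝ H) : wickOp q H (TensorAlgebra.ι ℝ f * u) =
    whiteNoise q f * wickOp q H u - wickOp q H (annihilationAlg (q : ℝ) f u) := by
  rw [whiteNoise_mul_wickOp, map_add, add_sub_cancel_right]

/-- The defining property of the Wick polynomials. -/
theorem wickOp_vacuum (u : TensorAlgebra ℝ H) : wickOp q H u (vacuum q H) = ofTensor q u := by
  -- Induction on degree rather than on the word: the recursion also involves the annihilated
  -- tensor, which is not a word but a combination of shorter ones. The kernel is that of `u ↦ W(u)
  -- Ω - u`.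
  have key : ∀ N, degreeLT H N ≤ LinearMap.ker
      (LinearMap.applyₗ (R := ℝ) (vacuum q H) ∘ₗ ContinuousLinearMap.coeLM ℝ ∘ₗ wickOp q H -
        ofTensor q) := by
    intro N
    induction N with
    -- The degree bound is strict, so nothing lies below `0` and the base case is empty; the empty
    -- word is treated in the successor step.
    | zero => exact degreeLT_le fun l hl => absurd hl (Nat.not_lt_zero _)
    | succ N ih =>
      have ih' : ∀ x ∈ degreeLT H N, wickOp q H x (vacuum q H) = ofTensor q x := fun x hx =>
        sub_eq_zero.1 (ih hx)
      refine degreeLT_le fun l hl => sub_eq_zero.2 ?_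
      change wickOp q H (wordTensor l) (vacuum q H) = ofTensor q (wordTensor l)
      cases l with
      | nil => rw [wordTensor_nil, wickOp_one]; rfl
      | cons f l =>
        have h := wordTensor_mem_degreeLT (Nat.lt_of_succ_lt_succ hl)
        rw [wordTensor_cons, wickOp_ι_mul, sub_apply, mul_apply_eq_comp, ih' _ h,
          ih' _ (annihilationAlg_mem_degreeLT _ f h), whiteNoise_ofTensor, map_add,
          add_sub_cancel_right]
  induction u using word_induction with
  | word l => exact sub_eq_zero.1 (key _ (wordTensor_mem_degreeLT (Nat.lt_succ_self l.length)))
  | add a b ha hb => rw [map_add, map_add, add_apply, ha, hb]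
  | smul c a ha => rw [map_smul, map_smul, smul_apply, ha]

/-! ### Wick polynomials fill out `𝒫`, and consequences for `I`. -/

theorem whiteNoise_mem (f : H) : whiteNoise q f ∈ NoisePoly q H :=
  Algebra.subset_adjoin ⟨f, rfl⟩

/-- A separate annihilation operator need not be a polynomial in the noise, so membership is not
visible from the normal ordered form; it comes from the recursion `wickOp_ι_mul`, by induction on
degree. -/
theorem wickOp_mem (u : TensorAlgebra ℝ H) : wickOp q H u ∈ NoisePoly q H := by
  have key : ∀ N, degreeLT H N ≤ (Subalgebra.toSubmodule (NoisePoly q H)).comap (wickOp q H) := by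
    intro N
    induction N with
    | zero => exact degreeLT_le fun l hl => absurd hl (Nat.not_lt_zero _)
    | succ N ih =>
      refine degreeLT_le fun l hl => ?_
      cases l with
      | nil => rw [wordTensor_nil, Submodule.mem_comap, wickOp_one]; exact one_mem (NoisePoly q H)
      | cons f l =>
        have h := wordTensor_mem_degreeLT (Nat.lt_of_succ_lt_succ hl)
        rw [wordTensor_cons, Submodule.mem_comap, wickOp_ι_mul]
        exact sub_mem (S := Submodule ℝ _) (Subalgebra.mul_mem _ (whiteNoise_mem q f) (ih h))
          (ih (annihilationAlg_mem_degreeLT _ f h))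
  induction u using word_induction with
  | word l => exact key _ (wordTensor_mem_degreeLT (Nat.lt_succ_self l.length))
  | add a b ha hb => rw [map_add]; exact add_mem ha hb
  | smul c a ha => rw [map_smul]; exact Subalgebra.smul_mem _ ha c

/-- The range of `W` is a left module over `𝒫`, because generators preserve it by
`whiteNoise_mul_wickOp`. The claim is made for all `u` since for a product `A B` the factor `A`
meets a new tensor. -/
theorem mul_wickOp_mem_range {A : Fock q H →L[ℝ] Fock q H} (hA : A ∈ NoisePoly q H)
    (u : TensorAlgebra ℝ H) : ∃ v, A * wickOp q H u = wickOp q H v := by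
  induction hA using Algebra.adjoin_induction generalizing u with
  | mem A hA =>
    obtain ⟨f, rfl⟩ := hA
    exact ⟨_, whiteNoise_mul_wickOp q f u⟩
  | algebraMap c =>
    exact ⟨c • u, by rw [Algebra.algebraMap_eq_smul_one, smul_mul_assoc, one_mul, map_smul]⟩
  | add A B _ _ hA hB =>
    obtain ⟨v, hv⟩ := hA u
    obtain ⟨w, hw⟩ := hB u
    exact ⟨v + w, by rw [add_mul, hv, hw, map_add]⟩
  | mul A B _ _ hA hB =>
    obtain ⟨v, hv⟩ := hB u
    obtain ⟨w, hw⟩ := hA v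
    exact ⟨w, by rw [mul_assoc, hv, hw]⟩

/-- The Wick polynomials exhaust `𝒫`: the inverse of `P ↦ P Ω`. -/
def wickEquiv (H : Type*) [NormedAddCommGroup H] [InnerProductSpace ℝ H] :
    TensorAlgebra ℝ H ≃ₗ[ℝ] NoisePoly q H :=
  LinearEquiv.ofBijective
    ((wickOp q H).codRestrict (Subalgebra.toSubmodule (NoisePoly q H)) (wickOp_mem q)) <| by
    constructor
    · intro u v h
      apply ofTensor_injective q
      rw [← wickOp_vacuum, ← wickOp_vacuum]
      exact congrArg (fun P : NoisePoly q H => (P : Fock q H →L[ℝ] Fock q H) (vacuum q H)) h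
    · rintro ⟨P, hP⟩
      -- Since `W(1) = 1`, the product `P W(1)` is `P` itself.
      obtain ⟨v, hv⟩ := mul_wickOp_mem_range q hP 1
      rw [wickOp_one, mul_one] at hv
      exact ⟨v, Subtype.ext hv.symm⟩

theorem coe_wickEquiv (u : TensorAlgebra ℝ H) :
    (wickEquiv q H u : Fock q H →L[ℝ] Fock q H) = wickOp q H u := rfl

theorem wickEquiv_one : wickEquiv q H 1 = 1 := Subtype.ext (wickOp_one q)

theorem vacuumUnitary_wickEquiv (u : TensorAlgebra ℝ H) :
    vacuumUnitary q H (toL2 q H (wickEquiv q H u)) = ofTensor q u := by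
  rw [vacuumUnitary_toL2, coe_wickEquiv, wickOp_vacuum]

/-- As `I` is isometric, orthogonality in `L²(μ)` reduces to orthogonality of tensors of different
degrees. -/
theorem inner_toL2_wickEquiv (u v : TensorAlgebra ℝ H) :
    ⟪toL2 q H (wickEquiv q H u), toL2 q H (wickEquiv q H v)⟫_ℝ = fockForm (q : ℝ) H u v := by
  rw [← (vacuumUnitary q H).inner_map_map, vacuumUnitary_wickEquiv, vacuumUnitary_wickEquiv]
  exact (toFock q).inner_map_map _ _

/-- The vacuum separates `𝒫`: a polynomial `W(u)` is determined by `W(u) Ω = u`. -/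
theorem toL2_injective : Function.Injective (toL2 q H) := by
  intro P₁ P₂ h
  obtain ⟨u, rfl⟩ := (wickEquiv q H).surjective P₁
  obtain ⟨v, rfl⟩ := (wickEquiv q H).surjective P₂
  have := congrArg (vacuumUnitary q H) h
  rw [vacuumUnitary_wickEquiv, vacuumUnitary_wickEquiv] at this
  rw [ofTensor_injective q this]

theorem vacuumUnitary_surjective : Function.Surjective (vacuumUnitary q H) := by
  -- The range of an isometry on a complete space is closed, and here it contains the dense set of
  -- finite vectors.
  rw [← Set.range_eq_univ, ← (vacuumUnitary q H).isometry.isClosedEmbedding.isClosed_range.closure_eq]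
  refine ((denseRange_toFock q).mono ?_).closure_eq
  rintro _ ⟨x, rfl⟩
  exact ⟨_, vacuumUnitary_wickEquiv q x⟩

/-! ### The Wick product of Wick polynomials -/

/-- Wick multiplication by `⟨ω, f⟩` on combinations of words. -/
def wordNoise (r : ℝ) (f : H) : Words H →ₗ[ℝ] Words H :=
  Finsupp.linearCombination ℝ fun p =>
    Finsupp.single (f :: p.1, p.2) 1 + r ^ p.1.length • Finsupp.single (p.1, f :: p.2) 1

theorem wordNoise_single (r : ℝ) (f : H) (p : List H × List H) :
    wordNoise r f (Finsupp.single p 1) =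
      Finsupp.single (f :: p.1, p.2) 1 + r ^ p.1.length • Finsupp.single (p.1, f :: p.2) 1 := by
  rw [wordNoise, Finsupp.linearCombination_single, one_smul]

/-- The Wick product on combinations of words. -/
def wordMul (r : ℝ) (H : Type*) [NormedAddCommGroup H] [InnerProductSpace ℝ H] :
    Words H →ₗ[ℝ] Words H →ₗ[ℝ] Words H :=
  Finsupp.linearCombination ℝ fun p => Finsupp.linearCombination ℝ fun p' =>
    r ^ (p'.1.length * p.2.length) • Finsupp.single (p.1 ++ p'.1, p.2 ++ p'.2) 1

theorem wordMul_single (r : ℝ) (p p' : List H × List H) :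
    wordMul r H (Finsupp.single p 1) (Finsupp.single p' 1) =
      r ^ (p'.1.length * p.2.length) • Finsupp.single (p.1 ++ p'.1, p.2 ++ p'.2) 1 := by
  simp only [wordMul, Finsupp.linearCombination_single, one_smul]

/-- `wordWick` has values in operators and cannot be iterated. Its lift `wordMul` stays among words,
where associativity can be expressed. -/
theorem wordOp_wordMul (x y : Words H) : wordOp q H (wordMul (q : ℝ) H x y) = wordWick q H x y := by
  have : (wordMul (q : ℝ) H).compr₂ (wordOp q H) = wordWick q H := by
    ext1 p
    ext1
    ext1 p'
    ext1
    simp only [LinearMap.comp_apply, Finsupp.lsingle_apply, LinearMap.compr₂_apply, wordMul_single,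
      map_smul, wordOp, wordWick, Finsupp.linearCombination_single, one_smul]
  exact LinearMap.congr_fun₂ this x y

/-- The instance of associativity of `⋄` in which the first factor is a noise variable. -/
theorem wordMul_wordNoise (r : ℝ) (f : H) (x y : Words H) :
    wordMul r H (wordNoise r f x) y = wordNoise r f (wordMul r H x y) := by
  have : wordMul r H ∘ₗ wordNoise r f = (wordMul r H).compr₂ (wordNoise r f) := by
    ext1 p
    ext1
    ext1 p'
    ext1
    simp only [LinearMap.comp_apply, Finsupp.lsingle_apply, LinearMap.compr₂_apply, wordMul_single,
      map_smul, wordNoise_single, map_add, LinearMap.add_apply, LinearMap.smul_apply,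
      List.cons_append, smul_add, smul_smul]
    congr 2
    -- Either way the new annihilator passes the creators of both words and each old annihilator of
    -- `p` passes those of `p'`: the exponent is `|p.1| + |p'.1| (|p.2| + 1)`.
    rw [← pow_add, ← pow_add, List.length_append, List.length_cons]
    congr 1
    ring
  exact LinearMap.congr_fun₂ this x y

/-- The normal ordered form of the Wick polynomial of a word. -/
def wickWord (r : ℝ) (l : List H) : Words H :=
  l.foldr (fun f x => wordNoise r f x) (Finsupp.single ([], []) 1)

/-- The noise variables of the left factor are pulled out one at a time, until the pair of empty
words remains, which is a left unit. -/
theorem wordMul_wickWord (r : ℝ) (l l' : List H) :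
    wordMul r H (wickWord r l) (wickWord r l') = wickWord r (l ++ l') := by
  induction l with
  | nil =>
    have : wordMul r H (Finsupp.single ([], []) 1) = LinearMap.id := by
      ext1 p
      ext1
      simp [wordMul_single]
    exact LinearMap.congr_fun this _
  | cons f l ih =>
    change wordMul r H (wordNoise r f (wickWord r l)) _ = wordNoise r f (wickWord r (l ++ l'))
    rw [wordMul_wordNoise, ih]

theorem wordSymbol_wordNoise (r : ℝ) (f : H) (x : Words H) :
    wordSymbol H (wordNoise r f x) = wickLeft r H f (wordSymbol H x) := by
  have : wordSymbol H ∘ₗ wordNoise r f = wickLeft r H f ∘ₗ wordSymbol H := by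
    ext1 p
    ext1
    simp only [LinearMap.comp_apply, Finsupp.lsingle_apply, wordNoise_single, map_add, map_smul,
      wordSymbol, Finsupp.linearCombination_single, one_smul, wickLeft_tmul, degreeScale_word,
      wordTensor_cons, List.reverse_cons, wordTensor_append, TensorProduct.smul_tmul',
      wordTensor_nil, mul_one]
  exact LinearMap.congr_fun this x

/-- Joins the two descriptions of `W`: symbols, on which contraction is computed, and words, on
which the Wick product is computed. Both iterate Wick multiplication by noise from the unit, so
`wordSymbol_wordNoise` identifies them. -/
theorem wordOp_wickWord (l : List H) :
    (wordOp q H (wickWord (q : ℝ) l) : Fock q H →L[ℝ] Fock q H) = wickOp q H (wordTensor l) := by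
  rw [← opSymbol_wordSymbol, wickOp, LinearMap.comp_apply]
  congr 1
  induction l with
  | nil =>
    rw [wordTensor_nil, wickSymbol_one]
    simp [wickWord, wordSymbol, wordTensor_nil]
  | cons f l ih =>
    rw [wordTensor_cons, wickSymbol_ι_mul, ← ih]
    exact wordSymbol_wordNoise _ _ _

theorem wickOp_mem_normalOrdered (u : TensorAlgebra ℝ H) : wickOp q H u ∈ NormalOrdered q H := by
  induction u using word_induction with
  | word l => rw [← wordOp_wickWord]; exact Subtype.property _
  | add a b ha hb => rw [map_add]; exact add_mem ha hb
  | smul c a ha => rw [map_smul]; exact Submodule.smul_mem _ c ha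

theorem noisePoly_le_normalOrdered :
    Subalgebra.toSubmodule (NoisePoly q H) ≤ NormalOrdered q H := by
  intro A hA
  obtain ⟨u, hu⟩ := (wickEquiv q H).surjective ⟨A, hA⟩
  rw [show A = wickOp q H u from (congrArg Subtype.val hu).symm]
  exact wickOp_mem_normalOrdered q u

/-- Wick polynomials as elements of `𝒲`. -/
def wickNormal (H : Type*) [NormedAddCommGroup H] [InnerProductSpace ℝ H] :
    TensorAlgebra ℝ H →ₗ[ℝ] NormalOrdered q H :=
  (wickOp q H).codRestrict (NormalOrdered q H) (wickOp_mem_normalOrdered q)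

theorem wickNormal_word (l : List H) :
    wickNormal q H (wordTensor l) = wordOp q H (wickWord (q : ℝ) l) :=
  Subtype.ext (wordOp_wickWord q l).symm

/-- The Wick product corresponds to the tensor product. -/
theorem wickProduct_wickNormal (u v : TensorAlgebra ℝ H) :
    wickProduct q H (wickNormal q H u) (wickNormal q H v) = wickNormal q H (u * v) := by
  have : (wickProduct q H).compl₁₂ (wickNormal q H) (wickNormal q H) =
      (LinearMap.mul ℝ (TensorAlgebra ℝ H)).compr₂ (wickNormal q H) := by
    -- Both sides are bilinear, so words suffice; there `wickProduct_wordOp` permits the particular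
    -- expressions `wickWord`, whose product is concatenation.
    refine hom_ext_words fun l => hom_ext_words fun l' => ?_
    rw [LinearMap.compl₁₂_apply, LinearMap.compr₂_apply, LinearMap.mul_apply', ← wordTensor_append,
      wickNormal_word, wickNormal_word, wickNormal_word, wickProduct_wordOp, ← wordOp_wordMul,
      wordMul_wickWord]
  exact LinearMap.congr_fun₂ this u v

/-- The Wick product on `𝒫`. -/
def wickMul (H : Type*) [NormedAddCommGroup H] [InnerProductSpace ℝ H] :
    NoisePoly q H →ₗ[ℝ] NoisePoly q H →ₗ[ℝ] NoisePoly q H :=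
  ((LinearMap.mul ℝ (TensorAlgebra ℝ H)).compr₂ (wickEquiv q H).toLinearMap).compl₁₂
    (wickEquiv q H).symm.toLinearMap (wickEquiv q H).symm.toLinearMap

theorem wickMul_wickEquiv (u v : TensorAlgebra ℝ H) :
    wickMul q H (wickEquiv q H u) (wickEquiv q H v) = wickEquiv q H (u * v) := by
  simp [wickMul]

/-! ### Orthogonalized monomials -/

theorem coe_noiseMonomial_succ {n : ℕ} (f : Fin (n + 1) → H) :
    (noiseMonomial q (n + 1) (PiTensorProduct.tprod ℝ f) : Fock q H →L[ℝ] Fock q H) =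
      whiteNoise q (f 0) * (noiseMonomial q n (PiTensorProduct.tprod ℝ (Fin.tail f)) :
        Fock q H →L[ℝ] Fock q H) := by
  rw [noiseMonomial_tprod, noiseMonomial_tprod, List.ofFn_succ, List.prod_cons]
  rfl

/-- A monomial is a Wick polynomial up to terms of lower order. -/
theorem exists_noiseMonomial_eq {n : ℕ} (z : ⨂[ℝ]^n H) : ∃ x ∈ degreeLT H n,
    noiseMonomial q n z = wickEquiv q H (TensorPower.toTensorAlgebra z + x) := by
  induction z using PiTensorProduct.induction_on with
  | add a b ha hb =>
    obtain ⟨x, hx, ha⟩ := ha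
    obtain ⟨y, hy, hb⟩ := hb
    refine ⟨x + y, add_mem hx hy, ?_⟩
    rw [map_add, ha, hb, ← map_add, map_add (TensorPower.toTensorAlgebra (R := ℝ) (M := H))]
    congr 1
    abel
  | smul_tprod c f =>
    suffices ∃ x ∈ degreeLT H n, noiseMonomial q n (PiTensorProduct.tprod ℝ f) =
        wickEquiv q H (TensorAlgebra.tprod ℝ H n f + x) by
      obtain ⟨x, hx, h⟩ := this
      refine ⟨c • x, Submodule.smul_mem _ c hx, ?_⟩
      rw [map_smul, h, ← map_smul, smul_add, map_smul TensorPower.toTensorAlgebra,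
        TensorPower.toTensorAlgebra_tprod]
    induction n with
    | zero =>
      refine ⟨0, zero_mem _, Subtype.ext ?_⟩
      rw [noiseMonomial_tprod, add_zero, tprod_zero_eq_one, wickEquiv_one]
      rfl
    | succ n ih =>
      obtain ⟨x, hx, h⟩ := ih (Fin.tail f)
      -- By `whiteNoise_mul_wickOp`, multiplying `W(g + x)` by `⟨ω, f 0⟩`, where `g` is the tensor
      -- of `Fin.tail f`, produces the leading tensor `f 0 ⊗ g` and precisely these remaining terms.
      refine ⟨TensorAlgebra.ι ℝ (f 0) * x + annihilationAlg (q : ℝ) (f 0)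
        (TensorAlgebra.tprod ℝ H n (Fin.tail f) + x),
        add_mem (ι_mul_mem_degreeLT _ hx) (annihilationAlg_mem_degreeLT _ _
          (add_mem ?_ (degreeLT_mono n.le_succ hx))), Subtype.ext ?_⟩
      · rw [← wordTensor_ofFn]
        exact wordTensor_mem_degreeLT (by simp)
      · rw [coe_noiseMonomial_succ, h, coe_wickEquiv, coe_wickEquiv, whiteNoise_mul_wickOp,
          tprod_succ, mul_add, add_assoc]

/-! ### The filtration `𝒫_k` and its orthogonal differences. -/

theorem toTensorAlgebra_mem_degreeLT {n : ℕ} (z : ⨂[ℝ]^n H) :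
    TensorPower.toTensorAlgebra z ∈ degreeLT H (n + 1) := by
  induction z using PiTensorProduct.induction_on with
  | smul_tprod c f =>
    rw [map_smul, TensorPower.toTensorAlgebra_tprod, ← wordTensor_ofFn]
    exact Submodule.smul_mem _ _ (wordTensor_mem_degreeLT (by simp))
  | add a b ha hb => rw [map_add]; exact add_mem ha hb

/-- Together with `map_degreeLT_le`, this shows that `W` carries the filtration by degree to the
filtration by order; `k + 1` appears because the degree bound is strict. -/
theorem polyLE_le (k : ℕ) : polyLE q H k ≤ (degreeLT H (k + 1)).map (wickEquiv q H).toLinearMap := by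
  refine iSup₂_le fun n hn => ?_
  rintro _ ⟨z, rfl⟩
  obtain ⟨x, hx, h⟩ := exists_noiseMonomial_eq q z
  refine ⟨_, ?_, h.symm⟩
  exact add_mem (degreeLT_mono (by omega) (toTensorAlgebra_mem_degreeLT z))
    (degreeLT_mono (by omega) hx)

/-- The relation between monomials and Wick polynomials is triangular with leading coefficient one,
hence can be inverted: `W` of a word is its monomial minus `W` of lower degrees, which are covered
by induction. -/
theorem map_degreeLT_le (k : ℕ) :
    (degreeLT H (k + 1)).map (wickEquiv q H).toLinearMap ≤ polyLE q H k := by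
  have mono : ∀ {m k : ℕ}, m ≤ k → polyLE q H m ≤ polyLE q H k := fun h =>
    biSup_mono fun n hn => hn.trans h
  -- Stated with degrees below `k` as hypothesis, so that `k = 0` needs no separate argument: there
  -- only `x = 0` has to be considered.
  have step : ∀ k, (∀ x ∈ degreeLT H k, wickEquiv q H x ∈ polyLE q H k) →
      ∀ x ∈ degreeLT H (k + 1), wickEquiv q H x ∈ polyLE q H k := by
    intro k ih
    change degreeLT H (k + 1) ≤ (polyLE q H k).comap (wickEquiv q H).toLinearMap
    refine degreeLT_le fun l hl => ?_
    change wickEquiv q H (wordTensor l) ∈ polyLE q H k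
    obtain ⟨x, hx, h⟩ := exists_noiseMonomial_eq q (PiTensorProduct.tprod ℝ l.get)
    rw [TensorPower.toTensorAlgebra_tprod, ← wordTensor_eq_tprod, map_add] at h
    rw [eq_sub_of_add_eq h.symm]
    refine sub_mem ?_ (ih x (degreeLT_mono (by omega) hx))
    exact (le_iSup₂_of_le (f := fun n (_ : n ≤ k) => LinearMap.range (noiseMonomial q n))
      l.length (by omega) le_rfl) ⟨_, rfl⟩
  have key : ∀ k, ∀ x ∈ degreeLT H (k + 1), wickEquiv q H x ∈ polyLE q H k := by
    intro k
    induction k with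
    | zero =>
      refine step 0 fun x hx => ?_
      have h0 : degreeLT H 0 ≤ ⊥ := degreeLT_le fun l hl => absurd hl (Nat.not_lt_zero _)
      rw [(Submodule.mem_bot ℝ).1 (h0 hx), map_zero]
      exact zero_mem _
    | succ k ih => exact step (k + 1) fun x hx => mono k.le_succ (ih x hx)
  exact Submodule.map_le_iff_le_comap.2 (key k)

theorem toL2_wickEquiv_mem (k : ℕ) {x : TensorAlgebra ℝ H} (hx : x ∈ degreeLT H (k + 1)) :
    toL2 q H (wickEquiv q H x) ∈ measurablePoly q H k :=
  Submodule.le_topologicalClosure _ ⟨_, map_degreeLT_le q k ⟨x, hx, rfl⟩, rfl⟩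

/-- A homogeneous tensor of degree `n` is orthogonal to all lower degrees, and `W` preserves scalar
products. -/
theorem toL2_wickEquiv_toTensorAlgebra_mem {n : ℕ} (z : ⨂[ℝ]^n H) :
    toL2 q H (wickEquiv q H (TensorPower.toTensorAlgebra z)) ∈ orthogonalPoly q H n := by
  have h := toL2_wickEquiv_mem q n (toTensorAlgebra_mem_degreeLT z)
  cases n with
  | zero => exact h
  | succ n =>
    refine ⟨h, ?_⟩
    -- Passing to the closure does not change the orthogonal complement, so only polynomials have to
    -- be tested.
    rw [measurablePoly, Submodule.orthogonal_closure]
    rintro _ ⟨P, hP, rfl⟩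
    obtain ⟨x, hx, rfl⟩ := polyLE_le q n hP
    rw [real_inner_comm]
    exact (inner_toL2_wickEquiv q _ _).trans (fockForm_toTensorAlgebra_degreeLT _ z hx)

/-- Lower degrees go into `ℳ𝒫_{n-1}`, to which `𝒪𝒫_n` is orthogonal by construction; for `n = 0`
there are none. -/
theorem toL2_wickEquiv_mem_orthogonal {n : ℕ} {x : TensorAlgebra ℝ H} (hx : x ∈ degreeLT H n) :
    toL2 q H (wickEquiv q H x) ∈ (orthogonalPoly q H n)ᗮ := by
  cases n with
  | zero =>
    have h0 : degreeLT H 0 ≤ ⊥ := degreeLT_le fun l hl => absurd hl (Nat.not_lt_zero _)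
    rw [(Submodule.mem_bot ℝ).1 (h0 hx), map_zero, map_zero]
    exact zero_mem _
  | succ n =>
    intro y hy
    rw [real_inner_comm]
    exact hy.2 _ (toL2_wickEquiv_mem q n hx)

/-- The splitting of a monomial into leading and lower part is its orthogonal decomposition along
`𝒪𝒫_n`, so the projection returns the leading part. In particular it remains in `𝒫`. -/
theorem wickMonomial_eq {n : ℕ} (z : ⨂[ℝ]^n H) :
    wickMonomial q n z = toL2 q H (wickEquiv q H (TensorPower.toTensorAlgebra z)) := by
  obtain ⟨x, hx, h⟩ := exists_noiseMonomial_eq q z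
  rw [wickMonomial, h, map_add, map_add]
  exact (Submodule.eq_starProjection_of_mem_orthogonal' (toL2_wickEquiv_toTensorAlgebra_mem q z)
    (toL2_wickEquiv_mem_orthogonal q hx) rfl)

end QWhiteNoise

end

open QWhiteNoise

/-! ### The corollary, by transport along `wickEquiv`. -/

theorem corollary3p2 {H : Type*} [NormedAddCommGroup H] [InnerProductSpace ℝ H] [CompleteSpace H]
    [TopologicalSpace.SeparableSpace H] (q : Set.Ioo (-1 : ℝ) 1) :
    -- `𝒫` is a subspace of `L²(μ)`, and the isometry `I` is unitary
    Function.Injective (toL2 q H) ∧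
    Function.Surjective (vacuumUnitary q H) ∧
    -- `𝒫 ⊆ 𝒲`, and the Wick product of `𝒲` restricts to a bilinear operation on `𝒫`
    ∃ hPW : Subalgebra.toSubmodule (NoisePoly q H) ≤ NormalOrdered q H,
    ∃ wickP : NoisePoly q H →ₗ[ℝ] NoisePoly q H →ₗ[ℝ] NoisePoly q H,
      (∀ P₁ P₂ : NoisePoly q H, (wickP P₁ P₂ : Fock q H →L[ℝ] Fock q H) =
        wickProduct q H (Submodule.inclusion hPW P₁) (Submodule.inclusion hPW P₂)) ∧
      -- which is associative with neutral element `1`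
      (∀ P₁ P₂ P₃ : NoisePoly q H, wickP (wickP P₁ P₂) P₃ = wickP P₁ (wickP P₂ P₃)) ∧
      (∀ P : NoisePoly q H, wickP 1 P = P ∧ wickP P 1 = P) ∧
      -- `I` maps `𝒫` onto the finite vectors and `⋄` to `⊗`
      (Set.range fun P : NoisePoly q H => vacuumUnitary q H (toL2 q H P)) =
        (finiteVectors q H : Set (Fock q H)) ∧
      (∀ (P₁ P₂ : NoisePoly q H) (u v : TensorAlgebra ℝ H),
        vacuumUnitary q H (toL2 q H P₁) = ofTensor q u →
        vacuumUnitary q H (toL2 q H P₂) = ofTensor q v →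
        vacuumUnitary q H (toL2 q H (wickP P₁ P₂)) = ofTensor q (u * v)) ∧
      -- `⟨:ω^{⊗n}:, f⟩ ⋄ ⟨:ω^{⊗m}:, g⟩ = ⟨:ω^{⊗(n+m)}:, f ⊗ g⟩` in `𝒫`
      (∀ (n : ℕ) (f : ⨂[ℝ]^n H), ∃ P : NoisePoly q H, toL2 q H P = wickMonomial q n f) ∧
      (∀ (n m : ℕ) (f : ⨂[ℝ]^n H) (g : ⨂[ℝ]^m H) (P₁ P₂ : NoisePoly q H),
        toL2 q H P₁ = wickMonomial q n f → toL2 q H P₂ = wickMonomial q m g →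
        toL2 q H (wickP P₁ P₂) = wickMonomial q (n + m) (TensorPower.mulEquiv (f ⊗ₜ[ℝ] g))) := by

  refine ⟨toL2_injective q, vacuumUnitary_surjective q, noisePoly_le_normalOrdered q,
    wickMul q H, ?_, ?_, ?_, ?_, ?_, ?_, ?_⟩
  · intro P₁ P₂
    obtain ⟨u, rfl⟩ := (wickEquiv q H).surjective P₁
    obtain ⟨v, rfl⟩ := (wickEquiv q H).surjective P₂
    rw [wickMul_wickEquiv]
    -- `wickMul` is defined by transport from the tensor algebra; here it is identified with the
    -- restriction of the Wick product of `𝒲`.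
    exact (congrArg Subtype.val (wickProduct_wickNormal q u v)).symm
  · intro P₁ P₂ P₃
    obtain ⟨u, rfl⟩ := (wickEquiv q H).surjective P₁
    obtain ⟨v, rfl⟩ := (wickEquiv q H).surjective P₂
    obtain ⟨w, rfl⟩ := (wickEquiv q H).surjective P₃
    simp only [wickMul_wickEquiv, mul_assoc]
  · intro P
    obtain ⟨u, rfl⟩ := (wickEquiv q H).surjective P
    simp only [← wickEquiv_one, wickMul_wickEquiv, one_mul, mul_one, and_self]
  · rw [← (wickEquiv q H).surjective.range_comp]
    simp only [Function.comp_def, vacuumUnitary_wickEquiv]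
    rfl
  · intro P₁ P₂ u v h₁ h₂
    -- Injectivity of `I` and of `𝒫 → L²(μ)` turns the hypotheses into `P₁ = W(u)` and `P₂ = W(v)`.
    rw [← vacuumUnitary_wickEquiv] at h₁ h₂
    obtain rfl := toL2_injective q ((vacuumUnitary q H).injective h₁)
    obtain rfl := toL2_injective q ((vacuumUnitary q H).injective h₂)
    rw [wickMul_wickEquiv, vacuumUnitary_wickEquiv]
  · exact fun n f => ⟨_, (wickMonomial_eq q f).symm⟩
  · intro n m f g P₁ P₂ h₁ h₂
    rw [wickMonomial_eq] at h₁ h₂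
    obtain rfl := toL2_injective q h₁
    obtain rfl := toL2_injective q h₂
    -- What remains is that the graded product of tensor powers becomes the product of the tensor
    -- algebra.
    rw [wickMonomial_eq, wickMul_wickEquiv, ← TensorPower.gMul_def,
      TensorPower.toTensorAlgebra_gMul]
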